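/- An R-factor is $R(ab,cd)$ (the indicial form of the Riemann tensor), and an R-monomial of degree $n$ is a rational scalar times a juxtaposition of $n$ R-factors in which each free index occurs once and each dummy index occurs exactly twice, once in the upper and once in the lower row. It is connected if the multigraph whose vertices are the R-factors and whose edges are the pairs of equal dummy indices is connected (in particular $n\ge 1$). Indices are ordered by: free indices $\prec$ integers (new dummy indices) $\prec$ input dummy indices. The algorithm $\mathrm{normal}$ proceeds as follows on a connected R-monomial $f$ without integer indices. (1) Record the upper free indices, drop the row characters, and compute the pre-normal form $\lambda g$ ($g$ monic) of $f$ by the branching procedure $\mathrm{pnom}$. This puts every R-factor in pre-normal form under $R(ab,cd)=-R(ba,cd)=R(cd,ab)$ and returns $0$ if some R-factor has two equal indices in one pair, and $\mu R(12,12)$ for a single R-factor $\mu R(b_1b_2,b_1b_2)$ without free index. Otherwise it starts from the sorted sequence of the R-factors with free indices; or, if there are none, from each R-factor with a loop (a dummy index occurring twice in it) in two ways; or, if there are none of these either, from each R-factor in $24$ ways. In each branch it repeatedly appends, in increasing order, the remaining R-factors that contain an already fixed index, and renames the old dummy indices of the first R-factor that still has some as the next integers. When the third and fourth indices of that R-factor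 are two different old dummy indices not occurring in its first pair, and the order of renaming them is not decided by an already placed R-factor containing one of them, both orders are tried, the second one in a new branch. Branches whose fixed part exceeds the current minimum are dropped; the lexicographic minimum is kept, and $0$ is returned when a complete branch equals the negative of the current minimum. (2) If the result of (1) is $0$, return $0$. If $n=1$, the result of (1) is kept. If $n>1$, run $\mathrm{Rebe}$ on $g$. Form the extension of $g$ by replacing the $i$-th R-factor $R(s_1s_2,s_3s_4)$, for every $i$ such that it has no loop, by $\lambda_{i2}R(s_1s_2,s_3s_4)+\lambda_{i3}R(s_1s_3,s_4s_2)+\lambda_{i4}R(s_1s_4,s_2s_3)$ and expanding. Apply $\mathrm{pnom}$ to all terms and combine like terms, which gives monomials $x_1\succ\dots\succ x_m$. For every loop-free $j$ set $\lambda_{j2}=\lambda_{j3}=\lambda_{j4}=1$ and equate the result to $0$; let $H$ be the coefficient matrix, over the field $\mathbb Q(\Lambda)$ of rational functions in the parameters. Repeat: compute the reduced row echelon form $Q$ of $H$ by Gauss–Jordan elimination; append the matrix of the rational terms of the entries of $Q$ to the output $\mathbf C$; subtract these terms from $Q$ and let the new $H$ consist of the columns from the first one in which $Q$ has an entry outside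 $\mathbb Q$; stop when $Q$ has no such column. Here the rational term is the $\mathbb Q$-linear map $\mathbb Q(\Lambda)\to\mathbb Q$ fixing $\mathbb Q$ obtained by taking, one parameter after another, the constant coefficient of the polynomial part of a quotient of polynomials. (3) Use the rows of $\mathbf C$ as elimination rules for their leading variables to rewrite $g$, multiply by $\lambda$, and restore the row characters in each term. Operations are counted as follows: inspecting, comparing or renaming an index, visiting or copying a list entry, and each operation in $\mathbb Q$ or $\mathbb Q(\Lambda)$ (arithmetic, zero test, membership in $\mathbb Q$, taking the rational term) count as one operation each. **Proposition.** There is an absolute constant $C$ such that for every connected R-monomial $f$ of degree $n$ without integer indices, the algorithm $\mathrm{normal}$ halts on $f$ after at most $C\,n\,9^n$ operations. -/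

import Mathlib

namespace RiemCanon

/-! ### Counted computations

A computation carries the number of elementary operations executed so far; a computation that
does not halt has the value `none`.  The elementary operations, one unit each, are: comparing or
inspecting an index, renaming an index at a seat, visiting or copying an entry of a list, and an
operation in `ℚ` or in the field `ℚ(Λ)` of rational functions in the extension parameters
(an arithmetic operation, a zero test, the test for lying in `ℚ`, taking the rational term). -/

abbrev Alg : Type → Type := StateT ℕ Option

/-- Charge `k` elementary operations. -/
def tick (k : ℕ) : Alg Unit := modify (· + k)

/-- The computation halts after at most `T` elementary operations. -/
def TakesAtMost {α : Type} (c : Alg α) (T : ℕ) : Prop :=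
  ∃ (a : α) (t : ℕ), c.run 0 = some (a, t) ∧ t ≤ T

/-- At most `N` rounds of an iteration, in which `Sum.inl` continues with a new state and `Sum.inr`
leaves the loop; the value is `none` if the loop has not been left by then. -/
def loopFor {σ β : Type} (body : σ → Alg (σ ⊕ β)) : ℕ → σ → Alg β
  | 0, _ => fun _ => none
  | N + 1, s => do
    match ← body s with
    | Sum.inl s' => loopFor body N s'
    | Sum.inr b => pure b

open Classical in
/-- Unbounded iteration: the common value of `loopFor` for all sufficiently large numbers of rounds,
which is `none` if the loop is never left. -/
noncomputable def loop {σ β : Type} (body : σ → Alg (σ ⊕ β)) (s : σ) : Alg β := fun t =>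
  if h : ∃ N, (loopFor body N s t).isSome then loopFor body (Nat.find h) s t else none

def mapT {α β : Type} (f : α → Alg β) : List α → Alg (List β)
  | [] => pure []
  | x :: xs => do
    tick 1
    let y ← f x
    let ys ← mapT f xs
    pure (y :: ys)

def foldT {α β : Type} (f : β → α → Alg β) : β → List α → Alg β
  | b, [] => pure b
  | b, x :: xs => do
    tick 1
    let b' ← f b x
    foldT f b' xs

def anyT {α : Type} (p : α → Alg Bool) : List α → Alg Bool
  | [] => pure false
  | x :: xs => do
    tick 1
    if ← p x then pure true else anyT p xs

/-- The elements that satisfy `p`, and the others. -/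
def partitionT {α : Type} (p : α → Alg Bool) : List α → Alg (List α × List α)
  | [] => pure ([], [])
  | x :: xs => do
    tick 1
    let c ← p x
    let r ← partitionT p xs
    if c then pure (x :: r.1, r.2) else pure (r.1, x :: r.2)

/-- The first element satisfying `p`, with its position counted from `i`. -/
def findT {α : Type} (p : α → Alg Bool) : ℕ → List α → Alg (Option (ℕ × α))
  | _, [] => pure none
  | i, x :: xs => do
    tick 1
    if ← p x then pure (some (i, x)) else findT p (i + 1) xs

/-- Concatenation, charged for copying the first list. -/
def appendT {α : Type} (l₁ l₂ : List α) : Alg (List α) := do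
  tick l₁.length
  pure (l₁ ++ l₂)

/-! ### Indices, R-factors, R-monomials -/

/-- Free indices, integer indices (the new dummy indices), and the dummy indices of the input. -/
inductive Idx where
  | free (k : ℕ)
  | int (k : ℕ)
  | dum (k : ℕ)
deriving DecidableEq

/-- The class of an index: free indices ≺ integers ≺ input dummy indices. -/
def Idx.cls : Idx → ℕ
  | .free _ => 0
  | .int _ => 1
  | .dum _ => 2

def Idx.num : Idx → ℕ
  | .free k => k
  | .int k => k
  | .dum k => k

def Idx.cmp (x y : Idx) : Ordering := (compare x.cls y.cls).then (compare x.num y.num)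

/-- An index is open when it is an input dummy index that has not been renamed to an integer;
otherwise it is fixed. -/
def Idx.isOpen : Idx → Bool
  | .dum _ => true
  | _ => false

def Idx.isFree : Idx → Bool
  | .free _ => true
  | _ => false

/-- A seat of a tensor: an index with its row character. -/
structure Seat where
  name : Idx
  upper : Bool
deriving DecidableEq

/-- `R(s₁ s₂, s₃ s₄)` with row characters. -/
structure RFactor where
  s₁ : Seat
  s₂ : Seat
  s₃ : Seat
  s₄ : Seat

def RFactor.seats (x : RFactor) : List Seat := [x.s₁, x.s₂, x.s₃, x.s₄]

/-- A scalar times a juxtaposition of R-factors. -/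
structure RMonomial where
  coef : ℚ
  factors : List RFactor

namespace RMonomial

def degree (f : RMonomial) : ℕ := f.factors.length

def seats (f : RMonomial) : List Seat := f.factors.flatMap RFactor.seats

/-- The indices of `f` are those of an R-monomial without integer indices: a free index occurs at
most once, and a dummy index occurs either not at all or exactly twice, once in each row. -/
def IsProper (f : RMonomial) : Prop :=
  (∀ k, (f.seats.map Seat.name).count (.free k) ≤ 1) ∧
  (∀ k, (f.seats.map Seat.name).count (.int k) = 0) ∧
  (∀ k, f.seats.count ⟨.dum k, true⟩ = f.seats.count ⟨.dum k, false⟩ ∧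
    f.seats.count ⟨.dum k, true⟩ ≤ 1)

/-- Two R-factors are adjacent in the multigraph of `f` when they share a dummy index. -/
def graph (f : RMonomial) : SimpleGraph (Fin f.factors.length) :=
  SimpleGraph.fromRel fun i j =>
    ∃ s ∈ (f.factors.get i).seats, ∃ t ∈ (f.factors.get j).seats, s.name = t.name

/-- The multigraph of `f` is connected (in particular it has a vertex). -/
def IsConnected (f : RMonomial) : Prop := f.graph.Connected

end RMonomial

/-- A scaled R-factor `λ R(ab, cd)` without row characters. -/
structure Factor where
  coef : ℚ
  a : Idx
  b : Idx
  c : Idx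
  d : Idx

def Factor.idx (x : Factor) : List Idx := [x.a, x.b, x.c, x.d]

/-- The index sequence of a sequence of R-factors. -/
def word (l : List Factor) : List Idx := l.flatMap Factor.idx

/-- A scalar times a sequence of monic R-factors; it stands for `0` when the scalar is `0`. -/
structure Mono where
  coef : ℚ
  factors : List Factor

/-! ### Elementary procedures on indices and R-factors -/

def cmpIdx (x y : Idx) : Alg Ordering := do
  tick 1
  pure (x.cmp y)

def eqIdx (x y : Idx) : Alg Bool := do
  tick 1
  pure (decide (x = y))

/-- Lexicographic comparison of index sequences. -/
def cmpWord : List Idx → List Idx → Alg Ordering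
  | [], [] => pure .eq
  | [], _ :: _ => pure .lt
  | _ :: _, [] => pure .gt
  | x :: xs, y :: ys => do
    match ← cmpIdx x y with
    | .eq => cmpWord xs ys
    | o => pure o

/-- Does the part of the first sequence before its first open index exceed the second sequence? -/
def exceeds : List Idx → List Idx → Alg Bool
  | x :: xs, y :: ys => do
    tick 1
    if x.isOpen then pure false
    else
      match ← cmpIdx x y with
      | .eq => exceeds xs ys
      | .gt => pure true
      | .lt => pure false
  | _, _ => pure false

/-- Sort the first pair: `R(ab, cd) = -R(ba, cd)`. -/
def sortFst (x : Factor) : Alg Factor := do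
  match ← cmpIdx x.b x.a with
  | .lt => tick 1; pure { x with coef := -x.coef, a := x.b, b := x.a }
  | _ => pure x

/-- Sort the second pair: `R(ab, cd) = -R(ab, dc)`. -/
def sortSnd (x : Factor) : Alg Factor := do
  match ← cmpIdx x.d x.c with
  | .lt => tick 1; pure { x with coef := -x.coef, c := x.d, d := x.c }
  | _ => pure x

/-- Sort the two pairs: `R(ab, cd) = R(cd, ab)`. -/
def sortPairs (x : Factor) : Alg Factor := do
  match ← cmpWord [x.c, x.d] [x.a, x.b] with
  | .lt => tick 1; pure { x with a := x.c, b := x.d, c := x.a, d := x.b }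
  | _ => pure x

/-- The pre-normal form of an R-factor. -/
def sortFactor (x : Factor) : Alg Factor := do
  let y ← sortFst x
  let z ← sortSnd y
  sortPairs z

def insertFactor (x : Factor) : List Factor → Alg (List Factor)
  | [] => do
    tick 1
    pure [x]
  | y :: ys => do
    tick 1
    match ← cmpWord x.idx y.idx with
    | .gt => do
      let r ← insertFactor x ys
      pure (y :: r)
    | _ => pure (x :: y :: ys)

/-- Increasing order. -/
def sortFactors : List Factor → Alg (List Factor)
  | [] => pure []
  | x :: xs => do
    tick 1
    let r ← sortFactors xs
    insertFactor x r

def inspect (p : Idx → Bool) (i : Idx) : Alg Bool := do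
  tick 1
  pure (p i)

def hasOpen (x : Factor) : Alg Bool := anyT (inspect Idx.isOpen) x.idx

def hasFixed (x : Factor) : Alg Bool := anyT (inspect fun i => !i.isOpen) x.idx

def hasFree (x : Factor) : Alg Bool := anyT (inspect Idx.isFree) x.idx

/-- Does some index occur twice in the list? -/
def hasRepeat : List Idx → Alg Bool
  | [] => pure false
  | x :: xs => do
    if ← anyT (eqIdx x) xs then pure true else hasRepeat xs

/-- Does the R-factor have a loop? -/
def hasLoop (x : Factor) : Alg Bool := hasRepeat x.idx

/-- Is the R-factor of the form `λ R(b₁b₁, b₂b₃)` or `λ R(b₁b₂, b₃b₃)`? -/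
def vanishes (x : Factor) : Alg Bool := do
  let u ← eqIdx x.a x.b
  let v ← eqIdx x.c x.d
  pure (u || v)

/-- Multiply the coefficients of the R-factors. -/
def collect (l : List Factor) : Alg Mono := do
  let c ← foldT (fun c x => do tick 1; pure (c * x.coef)) 1 l
  let m ← mapT (fun x => do tick 1; pure { x with coef := 1 }) l
  pure ⟨c, m⟩

/-! ### Pre-normal form of a connected R-monomial -/

/-- A branch: the next integer to be introduced, the sequence `Q_F` of R-factors having fixed
indices, and the remaining R-factors `Q_D`.  The set `V` of fixed indices of a branch consists of
the free indices and the integers, so that `V` is recognized by `Idx.isOpen`. -/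
structure Branch where
  next : ℕ
  qf : List Factor
  qd : List Factor

def renameSeat (i : Idx) (k : ℕ) (j : Idx) : Alg Idx := do
  tick 1
  if j = i then pure (.int k) else pure j

/-- Rename the index `i` as the integer `k`; the R-factor is kept in pre-normal form. -/
def renameFactor (i : Idx) (k : ℕ) (x : Factor) : Alg Factor := do
  let a ← renameSeat i k x.a
  let b ← renameSeat i k x.b
  let c ← renameSeat i k x.c
  let d ← renameSeat i k x.d
  sortFactor ⟨x.coef, a, b, c, d⟩

/-- Rename the index `i` as the next integer. -/
def Branch.rename (B : Branch) (i : Idx) : Alg Branch := do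
  let qf ← mapT (renameFactor i B.next) B.qf
  let qd ← mapT (renameFactor i B.next) B.qd
  tick 1
  pure ⟨B.next + 1, qf, qd⟩

/-- Rename the indices of the list one after another. -/
def Branch.renames (B : Branch) (l : List Idx) : Alg Branch := foldT Branch.rename B l

/-- The different open indices of `l` that are not in `seen`, in the order of occurrence. -/
def openIdx (seen : List Idx) : List Idx → Alg (List Idx)
  | [] => pure []
  | i :: l => do
    tick 1
    if ← inspect Idx.isOpen i then
      if ← anyT (eqIdx i) seen then openIdx seen l
      else do
        let r ← openIdx (i :: seen) l
        pure (i :: r)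
    else openIdx seen l

/-- The R-factor of `qf` (marked `true`) or of `qd` (marked `false`) that contains `i`. -/
def holder (i : Idx) (qf qd : List Factor) : Alg (Option (Bool × Factor)) := do
  match ← findT (fun x => anyT (eqIdx i) x.idx) 0 qf with
  | some r => pure (some (true, r.2))
  | none =>
    match ← findT (fun x => anyT (eqIdx i) x.idx) 0 qd with
    | some r => pure (some (false, r.2))
    | none => pure none

/-- The procedure `Branch`, for the R-factor at position `pos` of `Q_F`, whose third and fourth
indices `i`, `j` are open: the order of renaming them is decided by the R-factors containing them
elsewhere if one of these is in `Q_F`, and otherwise both orders are tried, the second one in a new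
branch. -/
def branchOn (p : Mono) (B : Branch) (pos : ℕ) (i j : Idx) : Alg (Branch × List Branch) := do
  tick B.qf.length
  let others := B.qf.eraseIdx pos
  let hi ← holder i others B.qd
  let hj ← holder j others B.qd
  let choice : Option Bool ← match hi, hj with
    | some (mi, yi), some (mj, yj) => do
      let o ← cmpWord yi.idx yj.idx
      if mi && o == .lt then pure (some true)
      else if mj && o == .gt then pure (some false)
      else pure none
    | _, _ => pure none
  match choice with
  | some true => do
    let B' ← B.renames [i, j]
    pure (B', [])
  | some false => do
    let B' ← B.renames [j, i]
    pure (B', [])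
  | none => do
    let B' ← B.renames [i, j]
    let B'' ← B.renames [j, i]
    if ← exceeds (word B''.qf) (word p.factors) then pure (B', []) else pure (B', [B''])

/-- Steps 1 and 2 of the procedure `SerIdx`.
Step 1: the R-factors of `Q_D` having fixed indices are moved, in increasing order, to the end
of `Q_F`.  Step 2: the open indices of the first R-factor `X` of `Q_F` having open indices are
renamed in the order of occurrence, except that `branchOn` renames those at the third and fourth
seats when these are two different indices not occurring at the first two seats. -/
def serStep (p : Mono) (B : Branch) : Alg (Branch × List Branch) := do
  let wr ← partitionT hasFixed B.qd
  let w ← mapT sortFactor wr.1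
  let w ← sortFactors w
  let qf ← appendT B.qf w
  let B : Branch := ⟨B.next, qf, wr.2⟩
  match ← findT hasOpen 0 qf with
  | none => pure (B, [])
  | some (pos, x) => do
    let u ← openIdx [] [x.a, x.b]
    let v ← openIdx u [x.c, x.d]
    let B ← B.renames u
    match v with
    | [i, j] => branchOn p B pos i j
    | _ => do
      let B ← B.renames v
      pure (B, [])

/-- The state of `pnom`: the serial number `K` of the current branch, the current minimum `p`, and
the branches still to be processed, the current one first. -/
structure PnomState where
  K : ℕ
  p : Mono
  queue : List Branch

/-- One round of the procedure `SerIdx`. -/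
def serIdx (s : PnomState) : Alg (PnomState ⊕ Mono) := do
  tick 1
  match s.queue with
  | [] => pure (.inr s.p)
  | B :: rest => do
    let r ← serStep s.p B
    let B' := r.1
    let rest' := rest ++ r.2
    if ← exceeds (word B'.qf) (word s.p.factors) then
      pure (.inl ⟨s.K + 1, s.p, rest'⟩)
    else do
      let u ← anyT hasFixed B'.qd
      let v ← anyT hasOpen B'.qf
      if u || v then pure (.inl ⟨s.K, s.p, B' :: rest'⟩)
      else do
        let q ← collect B'.qf
        if s.K = 1 then pure (.inl ⟨s.K + 1, q, rest'⟩)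
        else
          match ← cmpWord (word q.factors) (word s.p.factors) with
          | .lt => pure (.inl ⟨s.K + 1, q, rest'⟩)
          | .gt => pure (.inl ⟨s.K + 1, s.p, rest'⟩)
          | .eq => do
            tick 1
            if s.p.coef = -q.coef then pure (.inr ⟨0, []⟩)
            else pure (.inl ⟨s.K + 1, s.p, rest'⟩)

/-- The index of multiplicity 2 of an R-factor with one loop, and the two other indices. -/
def loopSplit (x : Factor) : Alg (Idx × Idx × Idx) := do
  if ← eqIdx x.a x.c then pure (x.a, x.b, x.d)
  else if ← eqIdx x.a x.d then pure (x.a, x.b, x.c)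
  else if ← eqIdx x.b x.c then pure (x.b, x.a, x.d)
  else pure (x.b, x.a, x.c)

/-- The branch led by the R-factor `x`, in which the indices in the list `l` are
renamed as 1, 2, … in this order. -/
def startBranch (x : Factor) (others : List Factor) (l : List Idx) : Alg Branch :=
  Branch.renames ⟨1, [x], others⟩ l

/-- For every element `x` of the list, all starting branches led by `x`; the other R-factors are the
other elements of the list and those of `before`. -/
def startBranches (orders : Factor → Alg (List (List Idx))) (before : List Factor) :
    List Factor → Alg (List Branch)
  | [] => pure []
  | x :: after => do
    tick 1
    let ls ← orders x
    let others ← appendT before after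
    let bs ← mapT (startBranch x others) ls
    let before' ← appendT before [x]
    let r ← startBranches orders before' after
    appendT bs r

/-- The two orders in which a leading Ricci R-factor is renamed. -/
def ricciOrders (x : Factor) : Alg (List (List Idx)) := do
  let b ← loopSplit x
  tick 6
  pure [[b.1, b.2.1, b.2.2], [b.1, b.2.2, b.2.1]]

/-- The 24 orders in which a leading complete R-factor is renamed. -/
def completeOrders (x : Factor) : Alg (List (List Idx)) := do
  tick 96
  pure x.idx.permutations

/-- `λ R(12, 12)` -/
def ricciScalar (c : ℚ) : Mono := ⟨c, [⟨1, .int 1, .int 2, .int 1, .int 2⟩]⟩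

/-- The pre-normal form of a connected R-monomial. -/
noncomputable def pnom (f₀ : List Factor) : Alg Mono := do
  let f ← mapT sortFactor f₀
  if ← anyT vanishes f then pure ⟨0, []⟩
  else do
    let ed ← partitionT hasFree f
    let e ← sortFactors ed.1
    let lc ← partitionT hasLoop ed.2
    let l := lc.1
    let c := lc.2
    let someOpen ← anyT hasOpen f
    if !someOpen then collect e
    else do
      let p ← collect f
      match e, l with
      | _ :: _, _ => do
        let qd ← appendT l c
        loop serIdx ⟨1, p, [⟨1, e, qd⟩]⟩
      | [], x :: l' =>
        if f.length = 1 then pure (ricciScalar x.coef)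
        else do
          let bs ← startBranches ricciOrders c (x :: l')
          loop serIdx ⟨1, p, bs⟩
      | [], [] => do
        let bs ← startBranches completeOrders [] c
        loop serIdx ⟨1, p, bs⟩

/-! ### The field of rational functions in the extension parameters -/

/-- The field of rational functions in one variable over a field. -/
noncomputable def adjoinVariable : (K : Type) × Field K → (K : Type) × Field K
  | ⟨K, inst⟩ => ⟨@RatFunc K inst.toCommRing, @RatFunc.instField K inst.toCommRing inferInstance⟩

/-- `ℚ(λ_0)(λ_1)…(λ_{k-1})`, with its field structure. -/
noncomputable def ratTower : ℕ → (K : Type) × Field K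
  | 0 => ⟨ℚ, inferInstance⟩
  | k + 1 => adjoinVariable (ratTower k)

/-- The field `ℚ(Λ)` of rational functions in `k` parameters. -/
def ParamField (k : ℕ) : Type := (ratTower k).1

noncomputable instance (k : ℕ) : Field (ParamField k) := (ratTower k).2

/-- The parameter `λ_i`, for `i < k`. -/
noncomputable def param : (k : ℕ) → ℕ → ParamField k
  | 0, _ => 0
  | k + 1, i =>
    if i = k then (RatFunc.X : RatFunc (ParamField k))
    else (RatFunc.C (K := ParamField k) (param k i))

/-- The term in `ℚ` of a rational function: a quotient of polynomials in the last parameter is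
divided with remainder, which splits it into a polynomial and a proper fraction, and the term in
`ℚ` is that of the constant term of the polynomial.  This map is `ℚ`-linear and fixes `ℚ`. -/
noncomputable def rationalTerm : (k : ℕ) → ParamField k → ℚ
  | 0, q => (q : ℚ)
  | k + 1, q =>
    rationalTerm k
      ((RatFunc.num (K := ParamField k) q /ₘ RatFunc.denom (K := ParamField k) q).coeff 0)

/-- Does the rational function lie in `ℚ`? -/
def IsRational {k : ℕ} (q : ParamField k) : Prop := ∃ c : ℚ, q = (c : ParamField k)

/-! ### Gauss-Jordan elimination -/

open Classical in
noncomputable def isZeroT {K : Type} [Field K] (x : K) : Alg Bool := do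
  tick 1
  pure (decide (x = 0))

/-- The entry of a row in column `c`. -/
noncomputable def entry {K : Type} [Field K] (r : List K) (c : ℕ) : K := r.getD c 0

/-- `r - x • s` -/
noncomputable def subRow {K : Type} [Field K] (x : K) : List K → List K → Alg (List K)
  | a :: r, b :: s => do
    tick 2
    let t ← subRow x r s
    pure ((a - x * b) :: t)
  | _, _ => pure []

/-- Make the entry in column `c` zero by subtracting a multiple of the pivot row. -/
noncomputable def clearRow {K : Type} [Field K] (c : ℕ) (piv r : List K) : Alg (List K) := do
  if ← isZeroT (entry r c) then pure r else subRow (entry r c) r piv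

/-- Treat column `c`: `S.1` are the rows with a pivot in the columns before `c`, and `S.2`
the other rows. -/
noncomputable def rrefStep {K : Type} [Field K] (S : List (List K) × List (List K)) (c : ℕ) :
    Alg (List (List K) × List (List K)) := do
  match ← findT (fun r => do
      let z ← isZeroT (entry r c)
      pure (!z)) 0 S.2 with
  | none => pure S
  | some (i, r) => do
    let piv ← mapT (fun x => do tick 1; pure (x / entry r c)) r
    tick S.2.length
    let done ← mapT (clearRow c piv) S.1
    let todo ← mapT (clearRow c piv) (S.2.eraseIdx i)
    let done' ← appendT done [piv]
    pure (done', todo)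

/-- The reduced row echelon form of a matrix with `b` columns given by its rows; zero rows are
removed. -/
noncomputable def rref {K : Type} [Field K] (b : ℕ) (H : List (List K)) : Alg (List (List K)) := do
  let S ← foldT rrefStep ([], H) (List.range b)
  pure S.1

/-! ### Bianchi relations in the extension of a connected R-monomial -/

/-- The terms of the extension: every loop-free R-factor `R(s₁s₂, s₃s₄)` is replaced by
`λ_{i0} R(s₁s₂, s₃s₄) + λ_{i1} R(s₁s₃, s₄s₂) + λ_{i2} R(s₁s₄, s₂s₃)`, where `i` is its position,
and an R-factor with loop is kept.  A term consists of its R-factors and the list of the pairs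
`(i, j)` of its parameters `λ_{ij}`.  The common parameter of the R-factors with loop is set to `1`
throughout. -/
def extension : ℕ → List Factor → Alg (List (List Factor × List (ℕ × ℕ)))
  | _, [] => pure [([], [])]
  | i, x :: xs => do
    let ts ← extension (i + 1) xs
    if ← hasLoop x then mapT (fun t => pure (x :: t.1, t.2)) ts
    else do
      let t₀ ← mapT (fun t => pure (x :: t.1, (i, 0) :: t.2)) ts
      let t₁ ← mapT (fun t => pure (⟨x.coef, x.a, x.c, x.d, x.b⟩ :: t.1, (i, 1) :: t.2)) ts
      let t₂ ← mapT (fun t => pure (⟨x.coef, x.a, x.d, x.b, x.c⟩ :: t.1, (i, 2) :: t.2)) ts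
      let t ← appendT t₁ t₂
      appendT t₀ t

/-- A monic pre-normal R-monomial with its coefficient, a sum of rational multiples of products
of parameters. -/
structure Entry where
  mono : List Factor
  coeff : List (ℚ × List (ℕ × ℕ))

/-- Insert a term into a list of like-term combined entries in descending order. -/
def insertTerm (mo : List Factor) (t : ℚ × List (ℕ × ℕ)) : List Entry → Alg (List Entry)
  | [] => do
    tick 1
    pure [⟨mo, [t]⟩]
  | e :: es => do
    tick 1
    match ← cmpWord (word mo) (word e.mono) with
    | .eq => pure (⟨e.mono, t :: e.coeff⟩ :: es)
    | .gt => pure (⟨mo, [t]⟩ :: e :: es)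
    | .lt => do
      let r ← insertTerm mo t es
      pure (e :: r)

/-- The pre-normal form of the extension after like term combination, its monomials
`x_1 ≻ x_2 ≻ … ≻ x_m` in descending order. -/
noncomputable def pnomExtension (f : List Factor) : Alg (List Entry) := do
  let ts ← extension 0 f
  foldT (fun g t => do
    let p ← pnom t.1
    if p.coef = 0 then pure g else insertTerm p.factors (p.coef, t.2) g) [] ts

/-- The value of a product of parameters, where `λ_{j0} = λ_{j1} = λ_{j2} = 1`. -/
noncomputable def paramProduct (k j : ℕ) (t : ℚ × List (ℕ × ℕ)) : Alg (ParamField k) :=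
  foldT (fun v ij => do
    tick 1
    if ij.1 = j then pure v else pure (v * param k (3 * ij.1 + ij.2)))
    (t.1 : ParamField k) t.2

/-- The value of a coefficient, where `λ_{j0} = λ_{j1} = λ_{j2} = 1`. -/
noncomputable def evalCoeff (k j : ℕ) (e : Entry) : Alg (ParamField k) :=
  foldT (fun v t => do
    let w ← paramProduct k j t
    tick 1
    pure (v + w)) 0 e.coeff

/-- The coefficient matrix of the Bianchi relations, one row for every loop-free R-factor, whose
position is counted from `j`. -/
noncomputable def bianchiRows (k : ℕ) (g : List Entry) :
    ℕ → List Factor → Alg (List (List (ParamField k)))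
  | _, [] => pure []
  | j, x :: xs => do
    let rows ← bianchiRows k g (j + 1) xs
    if ← hasLoop x then pure rows
    else do
      let row ← mapT (evalCoeff k j) g
      tick 1
      pure (row :: rows)

open Classical in
noncomputable def notRational {k : ℕ} (q : ParamField k) : Alg Bool := do
  tick 1
  pure (decide (¬ IsRational q))

/-- The number of columns before the first column, from column `c` on, that has an entry not in
`ℚ`; at most `d` columns are inspected. -/
noncomputable def rationalColumns {k : ℕ} (Q : List (List (ParamField k))) :
    ℕ → ℕ → Alg ℕ
  | _, 0 => pure 0
  | c, d + 1 => do
    tick 1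
    if ← anyT (fun r => notRational (entry r c)) Q then pure 0
    else do
      let r ← rationalColumns Q (c + 1) d
      pure (r + 1)

/-- The state of the iterated elimination: the current matrix `H`, its number of columns, the
number `q` of columns removed so far, and the rational rows obtained so far. -/
structure RebeState (k : ℕ) where
  H : List (List (ParamField k))
  cols : ℕ
  q : ℕ
  C : List (List ℚ)

/-- One round of the iterated elimination: the rational terms of the reduced row echelon form
`Q` of `H` are moved to `C`, and the rest of `Q`, from its first column having an
entry not in `ℚ` on, is the next matrix. -/
noncomputable def rebeStep {k : ℕ} (s : RebeState k) : Alg (RebeState k ⊕ List (List ℚ)) := do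
  tick 1
  let Q ← rref s.cols s.H
  let c ← rationalColumns Q 0 s.cols
  let W ← mapT (mapT fun x => do tick 1; pure (rationalTerm k x)) Q
  let W' ← mapT (appendT (List.replicate s.q 0)) W
  let C ← appendT s.C W'
  if c < s.cols then do
    let H ← mapT (fun r => do
      tick c
      mapT (fun x => do tick 2; pure (x - (rationalTerm k x : ParamField k))) (r.drop c)) Q
    pure (.inl ⟨H, s.cols - c, s.q + c, C⟩)
  else pure (.inr C)

/-- The unknowns `x_1 ≻ … ≻ x_m` of the Bianchi relations in the extension of a connected
R-monomial, and the coefficient rows of their complete row echelon form over `ℚ`. -/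
noncomputable def rebe (f : List Factor) : Alg (List (List Factor) × List (List ℚ)) := do
  let g ← pnomExtension f
  let k := 3 * f.length
  let H ← bianchiRows k g 0 f
  let C ← loop rebeStep ⟨H, g.length, 0, []⟩
  let h ← mapT (fun e => pure e.mono) g
  pure (h, C)

/-! ### Normal form of a connected R-monomial -/

/-- Rename the integers as dummy indices that are not integers. -/
def freshIdx (i : Idx) : Alg Idx := do
  tick 1
  match i with
  | .int k => pure (.dum k)
  | j => pure j

def freshFactor (x : Factor) : Alg Factor := do
  let a ← freshIdx x.a
  let b ← freshIdx x.b
  let c ← freshIdx x.c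
  let d ← freshIdx x.d
  pure ⟨x.coef, a, b, c, d⟩

/-- The row together with the column of its leading variable. -/
noncomputable def leading (row : List ℚ) : Alg (ℕ × List ℚ) := do
  match ← findT (fun x => do
      let z ← isZeroT x
      pure (!z)) 0 row with
  | some (i, _) => pure (i, row)
  | none => pure (row.length, row)

/-- Eliminate the variable of column `c` from the linear form `v`, if there is a rule for it. -/
noncomputable def eliminate (rules : List (ℕ × List ℚ)) (v : List ℚ) (c : ℕ) : Alg (List ℚ) := do
  if ← isZeroT (entry v c) then pure v
  else
    match ← findT (fun r => do tick 1; pure (decide (r.1 = c))) 0 rules with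
    | none => pure v
    | some (_, r) => subRow (entry v c) v r.2

/-- The variable `x_j` after applying the rows of `C` as elimination rules: it is replaced by
means of the row led by it, if there is one, and so on for the variables that appear. -/
noncomputable def applyRules (C : List (List ℚ)) (m j : ℕ) : Alg (List ℚ) := do
  let v ← mapT (fun i => do tick 1; pure (if i = j then (1 : ℚ) else 0)) (List.range m)
  let rules ← mapT leading C
  foldT (eliminate rules) v (List.range m)

/-- The linear combination of the monomials `h` with coefficients `c * v`. -/
noncomputable def combine (c : ℚ) : List (List Factor) → List ℚ → Alg (List Mono)
  | x :: h, a :: v => do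
    tick 2
    let r ← combine c h v
    if c * a = 0 then pure r else pure (⟨c * a, x⟩ :: r)
  | _, _ => pure []

/-- Remove the row characters. -/
def stripFactor (x : RFactor) : Alg Factor := do
  tick 4
  pure ⟨1, x.s₁.name, x.s₂.name, x.s₃.name, x.s₄.name⟩

/-- Restore the row character of an index: a free index is in the upper row if it belongs to the
record `U`, and otherwise in the lower row; a dummy index is in the upper row at its first
occurrence and in the lower row at its second occurrence in a term. The list `seen` consists of
the indices of the term that occurred before. -/
def restoreSeat (U seen : List Idx) (i : Idx) : Alg (Seat × List Idx) := do
  if ← inspect Idx.isFree i then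
    let u ← anyT (eqIdx i) U
    pure (⟨i, u⟩, seen)
  else do
    let u ← anyT (eqIdx i) seen
    pure (⟨i, !u⟩, i :: seen)

def restoreFactors (U : List Idx) : List Idx → List Factor → Alg (List RFactor)
  | _, [] => pure []
  | seen, x :: xs => do
    let a ← restoreSeat U seen x.a
    let b ← restoreSeat U a.2 x.b
    let c ← restoreSeat U b.2 x.c
    let d ← restoreSeat U c.2 x.d
    let r ← restoreFactors U d.2 xs
    tick 1
    pure (⟨a.1, b.1, c.1, d.1⟩ :: r)

def restore (U : List Idx) (p : Mono) : Alg RMonomial := do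
  let l ← restoreFactors U [] p.factors
  pure ⟨p.coef, l⟩

/-- The upper free indices. -/
def upperFree (l : List RFactor) : Alg (List Idx) :=
  foldT (fun U x =>
    foldT (fun U s => do
      if ← inspect Idx.isFree s.name then
        tick 1
        if s.upper then pure (s.name :: U) else pure U
      else pure U) U x.seats) [] l

/-- The algorithm `normal` on a connected R-monomial `f`; the value is the list of the terms of an
R-polynomial. -/
noncomputable def normal (f : RMonomial) : Alg (List RMonomial) := do
  let U ← upperFree f.factors
  let l ← mapT stripFactor f.factors
  let p ← pnom l
  tick 1
  let c := f.coef * p.coef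
  if c = 0 then pure []
  else do
    let terms : List Mono ←
      if f.factors.length = 1 then pure [⟨c, p.factors⟩]
      else do
        let fresh ← mapT freshFactor p.factors
        let r ← rebe fresh
        match ← findT (fun h => do
            let o ← cmpWord (word h) (word p.factors)
            pure (o == .eq)) 0 r.1 with
        | none => pure [⟨c, p.factors⟩]
        | some (j, _) => do
          let v ← applyRules r.2 r.1.length j
          combine c r.1 v
    mapT (restore U) terms

end RiemCanon

/-!
The cost of `normal` on a monomial of degree `n` is dominated by linear algebra with `m ≤ 3 ^ n`
unknowns and at most `n` relations, and by sorting the at most `3 ^ n` terms of the extension.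

*Pre-normal forms.* Renaming indices never destroys the property (`Paired`) that each index that
is not free occurs at least twice, so a branch of `pnom` never has more than `2 n` different open
indices (`Paired.card_openSet`). A round of `serIdx` finishes its branch, or removes an open index,
or removes two open indices and splits the branch in two (`Costs.serStep`). Hence a branch and its
descendants take `O(2 ^ n)` rounds (`roundBound`), each of polynomial cost; as there are at most
`24 n` starting branches, `pnom` takes `O(n³ 2ⁿ)`, hence `O(3ⁿ)` operations (`Costs.pnom`,
`cube_mul_two_pow_le`). The same invariant of branches shows that the result of `pnom` is again
`Paired`, as the run of `pnom` on its extension requires.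

*Extension.* Replacing the loop-free R-factors gives at most `3 ^ n` terms. Each of them costs a
pre-normal form, and an insertion into a list of at most `3 ^ n` words of length at most `4 n`:
`O(n 9ⁿ)` in all (`Costs.pnomExtension`).

*Elimination.* A single Gauss-Jordan elimination may need `n` pivots of cost `O(n m)`, and there may
be `m` rounds of elimination, which would only give `O(n² m²)`. But a pivot column has rational
entries, so that it is zero after the rational terms have been subtracted, unless it has been
removed; and a zero column remains zero. So all rounds together have at most `m` pivots
(`card_supportColumns_next`). Moreover the first column of a reduced matrix is rational, so that
every round but the last removes a column: there are at most `m + 1` rounds, of `O(n m)` besides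
the pivots. This gives `O(n m²)` (`Runs.rebeStep`, `Costs.rebe`). The rules obtained are no more than
the pivots, so that applying them costs `O(m²)` (`Costs.applyRules`).

The factor `n + 1` of these bounds becomes `n` because a connected monomial has an R-factor.
-/

namespace RiemCanon

/-! ### Cost calculus for counted computations -/

/-- The computation halts, from every counter value, with the same value `a` and the same number
`k` of additional operations, and these satisfy `P a k`. -/
def Runs {α : Type} (c : Alg α) (P : α → ℕ → Prop) : Prop :=
  ∃ a k, (∀ t, c t = some (a, t + k)) ∧ P a k

/-- The computation halts after at most `T` operations, with a value satisfying `P`. -/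
def Costs {α : Type} (c : Alg α) (T : ℕ) (P : α → Prop) : Prop :=
  Runs c fun a k => k ≤ T ∧ P a

section Rules

variable {α β σ : Type}

theorem Costs.takesAtMost {c : Alg α} {T : ℕ} {P : α → Prop} (h : Costs c T P) :
    TakesAtMost c T := by
  obtain ⟨a, k, h1, h2, -⟩ := h
  exact ⟨a, k, (h1 0).trans (by rw [Nat.zero_add]), h2⟩

theorem Runs.mono {c : Alg α} {P Q : α → ℕ → Prop} (h : Runs c P) (hPQ : ∀ a k, P a k → Q a k) :
    Runs c Q := by
  obtain ⟨a, k, h1, h2⟩ := h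
  exact ⟨a, k, h1, hPQ a k h2⟩

theorem Runs.pure {a : α} {P : α → ℕ → Prop} (h : P a 0) : Runs (pure a) P :=
  ⟨a, 0, fun _ => rfl, h⟩

theorem Runs.tick {n : ℕ} {P : Unit → ℕ → Prop} (h : P () n) : Runs (tick n) P :=
  ⟨(), n, fun _ => rfl, h⟩

theorem Runs.bind {c : Alg α} {f : α → Alg β} {P : α → ℕ → Prop} {Q : β → ℕ → Prop}
    (h : Runs c P) (hf : ∀ a k, P a k → Runs (f a) fun b k' => Q b (k + k')) :
    Runs (c >>= f) Q := by
  obtain ⟨a, k, h1, h2⟩ := h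
  obtain ⟨b, k', h3, h4⟩ := hf a k h2
  refine ⟨b, k + k', fun t => ?_, h4⟩
  change (c t).bind (fun p => f p.1 p.2) = _
  rw [h1, Option.bind_some, h3, add_assoc]

theorem Costs.mono {c : Alg α} {T T' : ℕ} {P P' : α → Prop} (h : Costs c T P) (hT : T ≤ T')
    (hP : ∀ a, P a → P' a) : Costs c T' P' :=
  Runs.mono h fun a _ hk => ⟨hk.1.trans hT, hP a hk.2⟩

theorem Costs.le {c : Alg α} {T T' : ℕ} {P : α → Prop} (h : Costs c T P) (hT : T ≤ T') :
    Costs c T' P :=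
  h.mono hT fun _ => id

theorem Costs.imp {c : Alg α} {T : ℕ} {P P' : α → Prop} (h : Costs c T P)
    (hP : ∀ a, P a → P' a) : Costs c T P' :=
  h.mono le_rfl hP

theorem Costs.trivial {c : Alg α} {T : ℕ} {P : α → Prop} (h : Costs c T P) :
    Costs c T fun _ => True :=
  h.imp fun _ _ => True.intro

theorem Costs.pure {a : α} {P : α → Prop} (h : P a) : Costs (pure a) 0 P :=
  Runs.pure ⟨le_rfl, h⟩

theorem Costs.tick {n : ℕ} : Costs (tick n) n fun _ => True :=
  Runs.tick ⟨le_rfl, True.intro⟩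

theorem Costs.bind {c : Alg α} {f : α → Alg β} {T₁ T₂ : ℕ} {P : α → Prop} {Q : β → Prop}
    (h : Costs c T₁ P) (hf : ∀ a, P a → Costs (f a) T₂ Q) : Costs (c >>= f) (T₁ + T₂) Q :=
  Runs.bind h fun a _ hk => Runs.mono (hf a hk.2) fun _ _ hk' => ⟨add_le_add hk.1 hk'.1, hk'.2⟩

theorem Costs.ite {p : Prop} [Decidable p] {c d : Alg α} {T₁ T₂ : ℕ} {P : α → Prop}
    (h₁ : p → Costs c T₁ P) (h₂ : ¬p → Costs d T₂ P) :
    Costs (if p then c else d) (T₁ + T₂) P := by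
  split_ifs with h
  · exact (h₁ h).le (Nat.le_add_right _ _)
  · exact (h₂ h).le (Nat.le_add_left _ _)

theorem exists_mem_left_of_forall₂ {R : α → β → Prop} {l : List α} {l' : List β}
    (h : List.Forall₂ R l l') {y : β} (hy : y ∈ l') : ∃ x ∈ l, R x y := by
  induction h with
  | nil => cases hy
  | @cons a b _ _ hab _ ih =>
    rcases List.mem_cons.mp hy with rfl | hy
    · exact ⟨a, by simp, hab⟩
    · obtain ⟨x, hx, hxy⟩ := ih hy
      exact ⟨x, by simp [hx], hxy⟩

/-- A traversal with a different bound and property for every element. -/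
theorem Costs.mapT_sum {f : α → Alg β} {T : α → ℕ} {R : α → β → Prop} {l : List α}
    (h : ∀ x ∈ l, Costs (f x) (T x) (R x)) :
    Costs (mapT f l) (l.length + (l.map T).sum) (fun l' => List.Forall₂ R l l') := by
  induction l with
  | nil => exact Costs.pure .nil
  | cons x xs ih =>
    rw [mapT]
    apply Costs.le
    · apply Costs.bind Costs.tick
      intro _ _
      apply Costs.bind (h x (by simp))
      intro y hy
      apply Costs.bind (ih fun z hz => h z (by simp [hz]))
      intro ys hys
      exact Costs.pure (.cons hy hys)
    · simp only [List.length_cons, List.map_cons, List.sum_cons]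
      omega

theorem Costs.mapT {f : α → Alg β} {T : ℕ} {R : α → β → Prop} {l : List α}
    (h : ∀ x ∈ l, Costs (f x) T (R x)) :
    Costs (mapT f l) (l.length * (T + 1)) (fun l' => List.Forall₂ R l l') := by
  refine (Costs.mapT_sum h).le (le_of_eq ?_)
  simp only [List.map_const', List.sum_replicate, smul_eq_mul]
  ring

/-- `I l b k`: after `k` operations, `b` is the value and `l` is what remains of the list. -/
theorem Runs.foldT {f : β → α → Alg β} {I : List α → β → ℕ → Prop}
    (hstep : ∀ x xs b k, I (x :: xs) b k → Runs (f b x) fun b' k' => I xs b' (k + 1 + k')) :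
    ∀ {l : List α} {b : β} {k : ℕ}, I l b k → Runs (foldT f b l) fun b' k' => I [] b' (k + k')
  | [], _, _, h => Runs.pure h
  | x :: xs, b, k, h => by
    rw [RiemCanon.foldT]
    refine Runs.bind (P := fun _ j => j = 1) (Runs.tick rfl) ?_
    rintro _ _ rfl
    refine Runs.bind (hstep x xs b k h) fun b' k' hb => ?_
    refine (Runs.foldT hstep hb).mono fun b'' k'' h'' => ?_
    simpa only [add_assoc] using h''

theorem Costs.foldT {f : β → α → Alg β} {T : ℕ} {I : List α → β → Prop}
    (hstep : ∀ x xs b, I (x :: xs) b → Costs (f b x) T (I xs)) {l : List α} {b : β} (h : I l b) :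
    Costs (foldT f b l) (l.length * (T + 1)) (I []) := by
  induction l generalizing b with
  | nil => exact (Costs.pure h).le (by simp)
  | cons x xs ih =>
    rw [RiemCanon.foldT]
    apply Costs.le
    · apply Costs.bind Costs.tick
      intro _ _
      apply Costs.bind (hstep x xs b h)
      intro b' hb'
      exact ih hb'
    · rw [List.length_cons, Nat.succ_mul]
      omega

theorem Costs.anyT {p : α → Alg Bool} {q : α → Bool} {T : ℕ} {l : List α}
    (h : ∀ x ∈ l, Costs (p x) T fun b => b = q x) :
    Costs (anyT p l) (l.length * (T + 1)) fun b => b = l.any q := by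
  induction l with
  | nil => exact (Costs.pure (by simp)).le (by simp)
  | cons x xs ih =>
    rw [RiemCanon.anyT]
    apply Costs.le
    · apply Costs.bind Costs.tick
      intro _ _
      apply Costs.bind (h x (by simp))
      rintro b rfl
      apply Costs.ite
      · intro hx
        exact Costs.pure (by simp [hx])
      · intro hx
        exact (ih fun z hz => h z (by simp [hz])).imp fun b hb => by simp [hb, hx]
    · rw [List.length_cons, Nat.succ_mul]
      omega

theorem Costs.partitionT {p : α → Alg Bool} {q : α → Bool} {T : ℕ} {l : List α}
    (h : ∀ x ∈ l, Costs (p x) T fun b => b = q x) :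
    Costs (partitionT p l) (l.length * (T + 1))
      fun r => r = (l.filter q, l.filter fun x => !q x) := by
  induction l with
  | nil => exact (Costs.pure (by simp)).le (by simp)
  | cons x xs ih =>
    rw [RiemCanon.partitionT]
    apply Costs.le
    · apply Costs.bind Costs.tick
      intro _ _
      apply Costs.bind (h x (by simp))
      rintro b rfl
      apply Costs.bind (ih fun z hz => h z (by simp [hz]))
      rintro r rfl
      apply Costs.ite
      · intro hx
        exact Costs.pure (by simp [hx])
      · intro hx
        exact Costs.pure (by simp [hx])
    · rw [List.length_cons, Nat.succ_mul]
      omega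

theorem Costs.findT {p : α → Alg Bool} {q : α → Bool} {T : ℕ} {l : List α} {i : ℕ}
    (h : ∀ x ∈ l, Costs (p x) T fun b => b = q x) :
    Costs (findT p i l) (l.length * (T + 1)) fun r =>
      match r with
      | none => ∀ x ∈ l, q x = false
      | some (j, x) => x ∈ l ∧ q x = true ∧ i ≤ j ∧ j < i + l.length := by
  induction l generalizing i with
  | nil => exact (Costs.pure (by simp)).le (by simp)
  | cons x xs ih =>
    rw [RiemCanon.findT]
    apply Costs.le
    · apply Costs.bind Costs.tick
      intro _ _
      apply Costs.bind (h x (by simp))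
      rintro b rfl
      apply Costs.ite
      · intro hx
        exact Costs.pure (by simp [hx])
      · intro hx
        refine (ih (i := i + 1) fun z hz => h z (by simp [hz])).imp fun r hr => ?_
        match r, hr with
        | none, hr => exact List.forall_mem_cons.mpr ⟨Bool.eq_false_iff.mpr hx, hr⟩
        | some (j, y), hr =>
          obtain ⟨h1, h2, h3, h4⟩ := hr
          exact ⟨by simp [h1], h2, by omega, by simp only [List.length_cons]; omega⟩
    · rw [List.length_cons, Nat.succ_mul]
      omega

theorem Costs.appendT {l₁ l₂ : List α} :
    Costs (appendT l₁ l₂) l₁.length fun l => l = l₁ ++ l₂ := by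
  rw [RiemCanon.appendT]
  apply Costs.bind (T₂ := 0) Costs.tick
  intro _ _
  exact Costs.pure rfl

theorem loopFor_succ {body : σ → Alg (σ ⊕ β)} {N : ℕ} {s : σ} {t : ℕ} {r : β × ℕ}
    (h : loopFor body N s t = some r) : loopFor body (N + 1) s t = some r := by
  induction N generalizing s t with
  | zero => cases h
  | succ N ih =>
    rw [loopFor] at h ⊢
    change (body s t).bind _ = _ at h
    change (body s t).bind _ = _
    rcases hb : body s t with _ | ⟨s' | b, t'⟩
    · rw [hb] at h
      cases h
    · rw [hb] at h
      exact ih h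
    · rw [hb] at h
      exact h

theorem loopFor_mono {body : σ → Alg (σ ⊕ β)} {N M : ℕ} (hNM : N ≤ M) {s : σ} {t : ℕ}
    {r : β × ℕ} (h : loopFor body N s t = some r) : loopFor body M s t = some r := by
  induction M, hNM using Nat.le_induction with
  | base => exact h
  | succ M _ ih => exact loopFor_succ ih

theorem loop_eq_of_loopFor {body : σ → Alg (σ ⊕ β)} {N : ℕ} {s : σ} {t : ℕ} {r : β × ℕ}
    (h : loopFor body N s t = some r) : loop body s t = some r := by
  classical
  have hex : ∃ N, (loopFor body N s t).isSome := ⟨N, by simp [h]⟩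
  rw [loop, dif_pos hex]
  obtain ⟨r', hr'⟩ := Option.isSome_iff_exists.mp (Nat.find_spec hex)
  rw [hr', ← loopFor_mono (le_max_left _ N) hr', loopFor_mono (le_max_right _ _) h]

/-- Amortized analysis of an iteration: a round that lowers the potential `μ` by at least
`d ≥ 1` may take `A * d` operations. -/
theorem Costs.loop {body : σ → Alg (σ ⊕ β)} {A : ℕ} {μ : σ → ℕ} {I : σ → Prop} {Q : β → Prop}
    (hbody : ∀ s, I s → Runs (body s) fun r k =>
      match r with
      | .inl s' => I s' ∧ ∃ d, 1 ≤ d ∧ μ s' + d ≤ μ s ∧ k ≤ A * d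
      | .inr b => Q b ∧ k ≤ A * (μ s + 1)) {s : σ} (hs : I s) :
    Costs (loop body s) (A * (μ s + 1)) Q := by
  have key : ∀ m s, I s → μ s ≤ m →
      ∃ N, Costs (loopFor body N s) (A * (μ s + 1)) Q := by
    intro m
    induction m with
    | zero =>
      intro s hs hm
      refine ⟨1, ?_⟩
      rw [loopFor]
      refine Runs.bind (hbody s hs) fun r k hr => ?_
      match r, hr with
      | .inl s', hr =>
        obtain ⟨-, d, h1, h2, -⟩ := hr
        omega
      | .inr b, hr => exact Runs.pure ⟨hr.2, hr.1⟩
    | succ m ih =>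
      intro s hs hm
      obtain ⟨r, k, hrun, hr⟩ := hbody s hs
      match r, hrun, hr with
      | .inl s', hrun, hr =>
        obtain ⟨hs', d, h1, h2, hk⟩ := hr
        obtain ⟨N, hN⟩ := ih s' hs' (by omega)
        refine ⟨N + 1, ?_⟩
        rw [loopFor]
        refine Runs.bind (P := fun a j => a = .inl s' ∧ j = k) ⟨_, k, hrun, rfl, rfl⟩ ?_
        rintro _ k ⟨rfl, rfl⟩
        refine Runs.mono hN fun b k' hk' => ⟨?_, hk'.2⟩
        calc k + k' ≤ A * d + A * (μ s' + 1) := add_le_add hk hk'.1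
          _ = A * (μ s' + d + 1) := by ring
          _ ≤ A * (μ s + 1) := by gcongr
      | .inr b, hrun, hr =>
        refine ⟨1, ?_⟩
        rw [loopFor]
        refine Runs.bind (P := fun a j => a = .inr b ∧ j = k) ⟨_, k, hrun, rfl, rfl⟩ ?_
        rintro _ _ ⟨rfl, rfl⟩
        exact Runs.pure ⟨hr.2, hr.1⟩
  obtain ⟨N, a, k, hrun, hk⟩ := key (μ s) s hs le_rfl
  exact ⟨a, k, fun t => loop_eq_of_loopFor (hrun t), hk⟩

end Rules

/-! ### Index words -/

/-- Every index of the word that is not free occurs at least twice in it. -/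
def Paired (w : List Idx) : Prop :=
  ∀ i ∈ w, i.isFree = false → 2 ≤ w.count i

/-- The different open indices of a word. -/
def openSet (w : List Idx) : Finset Idx :=
  w.toFinset.filter fun i => i.isOpen = true

theorem mem_openSet {w : List Idx} {i : Idx} : i ∈ openSet w ↔ i ∈ w ∧ i.isOpen = true := by
  simp [openSet]

theorem openSet_perm {w w' : List Idx} (h : w.Perm w') : openSet w = openSet w' := by
  ext i
  simp only [mem_openSet, h.mem_iff]

theorem Paired.perm {w w' : List Idx} (hw : Paired w) (h : w.Perm w') : Paired w' := by
  intro i hi hf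
  rw [← h.count_eq]
  exact hw i (h.mem_iff.mpr hi) hf

theorem Paired.map {w : List Idx} (hw : Paired w) {ρ : Idx → Idx}
    (hρ : ∀ i, (ρ i).isFree = i.isFree) : Paired (w.map ρ) := by
  intro j hj hf
  obtain ⟨i, hi, rfl⟩ := List.mem_map.mp hj
  exact (hw i hi (by rw [← hρ, hf])).trans List.count_le_count_map

theorem Paired.card_openSet {w : List Idx} (hw : Paired w) : 2 * (openSet w).card ≤ w.length := by
  have hsub : openSet w ⊆ w.toFinset := Finset.filter_subset _ _
  calc 2 * (openSet w).card = ∑ _i ∈ openSet w, 2 := by simp [mul_comm]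
    _ ≤ ∑ i ∈ openSet w, w.count i := by
        refine Finset.sum_le_sum fun i hi => ?_
        obtain ⟨h1, h2⟩ := mem_openSet.mp hi
        refine hw i h1 ?_
        cases i <;> simp_all [Idx.isOpen, Idx.isFree]
    _ ≤ ∑ i ∈ w.toFinset, w.count i :=
        Finset.sum_le_sum_of_subset hsub
    _ = w.length := List.sum_toFinset_count_eq_length w

theorem word_append (l₁ l₂ : List Factor) : word (l₁ ++ l₂) = word l₁ ++ word l₂ :=
  List.flatMap_append

theorem length_word (l : List Factor) : (word l).length = 4 * l.length := by
  induction l with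
  | nil => rfl
  | cons x l ih =>
    change (x.idx ++ word l).length = _
    rw [List.length_append, ih, List.length_cons]
    change 4 + _ = _
    ring

theorem word_perm {l l' : List Factor} (h : l.Perm l') : (word l).Perm (word l') :=
  h.flatMap_right _

theorem word_perm_map {ρ : Idx → Idx} {l l' : List Factor}
    (h : List.Forall₂ (fun x y : Factor => y.idx.Perm (x.idx.map ρ)) l l') :
    (word l').Perm ((word l).map ρ) := by
  induction h with
  | nil => exact .nil
  | @cons x y l l' hxy _ ih =>
    change (y.idx ++ word l').Perm ((x.idx ++ word l).map ρ)
    rw [List.map_append]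
    exact hxy.append ih

theorem word_perm_of_forall₂ {l l' : List Factor}
    (h : List.Forall₂ (fun x y : Factor => y.idx.Perm x.idx) l l') :
    (word l').Perm (word l) := by
  simpa using word_perm_map (ρ := id) (by simpa using h)

theorem mem_word {l : List Factor} {i : Idx} : i ∈ word l ↔ ∃ x ∈ l, i ∈ x.idx :=
  List.mem_flatMap

/-! ### Elementary procedures -/

theorem Costs.cmpIdx (x y : Idx) : Costs (cmpIdx x y) 1 fun _ => True :=
  (Costs.bind (T₂ := 0) Costs.tick fun _ _ => Costs.pure True.intro)

theorem Costs.eqIdx (x y : Idx) : Costs (eqIdx x y) 1 fun b => b = decide (x = y) :=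
  (Costs.bind (T₂ := 0) Costs.tick fun _ _ => Costs.pure rfl)

theorem Costs.inspect (p : Idx → Bool) (i : Idx) : Costs (inspect p i) 1 fun b => b = p i :=
  (Costs.bind (T₂ := 0) Costs.tick fun _ _ => Costs.pure rfl)

theorem Costs.cmpWord (l₁ l₂ : List Idx) : Costs (cmpWord l₁ l₂) l₁.length fun _ => True := by
  induction l₁ generalizing l₂ with
  | nil => cases l₂ <;> exact Costs.pure True.intro
  | cons x xs ih =>
    cases l₂ with
    | nil => exact (Costs.pure True.intro).le (Nat.zero_le _)
    | cons y ys =>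
      rw [RiemCanon.cmpWord, List.length_cons, add_comm]
      apply Costs.bind (Costs.cmpIdx x y)
      intro o _
      cases o
      · exact (Costs.pure True.intro).le (Nat.zero_le _)
      · exact ih ys
      · exact (Costs.pure True.intro).le (Nat.zero_le _)

theorem Costs.exceeds (l₁ l₂ : List Idx) : Costs (exceeds l₁ l₂) (2 * l₁.length) fun _ => True := by
  induction l₁ generalizing l₂ with
  | nil => exact Costs.pure True.intro
  | cons x xs ih =>
    cases l₂ with
    | nil => exact (Costs.pure True.intro).le (Nat.zero_le _)
    | cons y ys =>
      rw [RiemCanon.exceeds]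
      apply Costs.le (T := 1 + (0 + (1 + 2 * xs.length)))
      · apply Costs.bind Costs.tick
        intro _ _
        apply Costs.ite
        · intro _
          exact Costs.pure True.intro
        · intro _
          apply Costs.bind (Costs.cmpIdx x y)
          intro o _
          cases o
          · exact (Costs.pure True.intro).le (Nat.zero_le _)
          · exact ih ys
          · exact (Costs.pure True.intro).le (Nat.zero_le _)
      · rw [List.length_cons]
        omega

theorem Costs.sortFst (x : Factor) : Costs (sortFst x) 2 fun y => y.idx.Perm x.idx := by
  apply Costs.bind (T₁ := 1) (T₂ := 1) (Costs.cmpIdx _ _)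
  intro o _
  cases o
  · exact Costs.bind (T₂ := 0) Costs.tick fun _ _ => Costs.pure (.swap _ _ _)
  · exact (Costs.pure (.refl _)).le (Nat.zero_le _)
  · exact (Costs.pure (.refl _)).le (Nat.zero_le _)

theorem Costs.sortSnd (x : Factor) : Costs (sortSnd x) 2 fun y => y.idx.Perm x.idx := by
  apply Costs.bind (T₁ := 1) (T₂ := 1) (Costs.cmpIdx _ _)
  intro o _
  cases o
  · exact Costs.bind (T₂ := 0) Costs.tick fun _ _ => Costs.pure (.cons _ (.cons _ (.swap _ _ _)))
  · exact (Costs.pure (.refl _)).le (Nat.zero_le _)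
  · exact (Costs.pure (.refl _)).le (Nat.zero_le _)

theorem Costs.sortPairs (x : Factor) : Costs (sortPairs x) 3 fun y => y.idx.Perm x.idx := by
  apply Costs.bind (T₁ := 2) (T₂ := 1) (Costs.cmpWord _ _)
  intro o _
  cases o
  · exact Costs.bind (T₂ := 0) Costs.tick fun _ _ =>
      Costs.pure (List.perm_append_comm (l₁ := [x.c, x.d]) (l₂ := [x.a, x.b]))
  · exact (Costs.pure (.refl _)).le (Nat.zero_le _)
  · exact (Costs.pure (.refl _)).le (Nat.zero_le _)

theorem Costs.sortFactor (x : Factor) : Costs (sortFactor x) 7 fun y => y.idx.Perm x.idx := by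
  apply Costs.bind (T₁ := 2) (T₂ := 5) (Costs.sortFst x)
  intro y hy
  apply Costs.bind (T₁ := 2) (T₂ := 3) (Costs.sortSnd y)
  intro z hz
  exact (Costs.sortPairs z).imp fun w hw => hw.trans (hz.trans hy)

theorem Costs.insertFactor (x : Factor) (l : List Factor) :
    Costs (insertFactor x l) (5 * (l.length + 1)) fun l' => l'.Perm (x :: l) := by
  induction l with
  | nil =>
    exact (Costs.bind (T₂ := 0) Costs.tick fun _ _ => Costs.pure (.refl _)).le (by simp)
  | cons y ys ih =>
    rw [RiemCanon.insertFactor]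
    apply Costs.le (T := 1 + (4 + 5 * (ys.length + 1)))
    · apply Costs.bind Costs.tick
      intro _ _
      apply Costs.bind (T₁ := 4) (Costs.cmpWord x.idx y.idx)
      intro o _
      cases o
      · exact (Costs.pure (.refl _)).le (Nat.zero_le _)
      · exact (Costs.pure (.refl _)).le (Nat.zero_le _)
      · exact Costs.bind (T₂ := 0) ih fun r hr =>
          Costs.pure ((hr.cons y).trans (.swap _ _ _))
    · rw [List.length_cons]
      omega

theorem Costs.sortFactors (l : List Factor) :
    Costs (sortFactors l) (6 * l.length ^ 2) fun l' => l'.Perm l := by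
  induction l with
  | nil => exact (Costs.pure (.refl _)).le (Nat.zero_le _)
  | cons x xs ih =>
    rw [RiemCanon.sortFactors]
    apply Costs.le (T := 1 + (6 * xs.length ^ 2 + 5 * (xs.length + 1)))
    · apply Costs.bind Costs.tick
      intro _ _
      apply Costs.bind ih
      intro r hr
      have h := Costs.insertFactor x r
      rw [hr.length_eq] at h
      exact h.imp fun l' hl' => hl'.trans (hr.cons x)
    · rw [List.length_cons]
      nlinarith

theorem Costs.anyIdx (p : Idx → Bool) (x : Factor) :
    Costs (RiemCanon.anyT (RiemCanon.inspect p) x.idx) 8 fun b => b = x.idx.any p :=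
  Costs.anyT fun i _ => Costs.inspect p i

theorem Costs.hasOpen (x : Factor) : Costs (hasOpen x) 8 fun b => b = x.idx.any Idx.isOpen :=
  Costs.anyIdx _ x

theorem Costs.hasFixed (x : Factor) :
    Costs (hasFixed x) 8 fun b => b = x.idx.any fun i => !i.isOpen :=
  Costs.anyIdx _ x

theorem Costs.hasFree (x : Factor) : Costs (hasFree x) 8 fun b => b = x.idx.any Idx.isFree :=
  Costs.anyIdx _ x

theorem Costs.hasRepeat (l : List Idx) :
    Costs (hasRepeat l) (2 * l.length ^ 2) fun _ => True := by
  induction l with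
  | nil => exact Costs.pure True.intro
  | cons x xs ih =>
    rw [RiemCanon.hasRepeat]
    apply Costs.le
    · apply Costs.bind (Costs.anyT (q := fun y => decide (x = y)) fun y _ => Costs.eqIdx x y)
      intro b _
      apply Costs.ite
      · intro _
        exact Costs.pure True.intro
      · intro _
        exact ih
    · rw [List.length_cons]
      nlinarith

theorem Costs.hasLoop (x : Factor) : Costs (hasLoop x) 32 fun _ => True :=
  Costs.hasRepeat x.idx

theorem Costs.vanishes (x : Factor) : Costs (vanishes x) 2 fun _ => True := by
  apply Costs.bind (T₁ := 1) (T₂ := 1) (Costs.eqIdx _ _)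
  intro u _
  apply Costs.bind (T₁ := 1) (T₂ := 0) (Costs.eqIdx _ _)
  intro v _
  exact Costs.pure True.intro

/-- A computation whose value is not described has some value all the same. -/
theorem Costs.exists_eq {α β : Type} {p : α → Alg β} {T : ℕ} {P : β → Prop}
    (h : ∀ x, Costs (p x) T P) : ∃ q : α → β, ∀ x, Costs (p x) T fun b => b = q x := by
  choose q k h1 h2 using h
  exact ⟨q, fun x => ⟨q x, k x, h1 x, (h2 x).1, rfl⟩⟩

theorem Costs.collect (l : List Factor) :
    Costs (collect l) (4 * l.length) fun p =>
      p.factors.length = l.length ∧ (word p.factors).Perm (word l) := by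
  rw [RiemCanon.collect]
  apply Costs.le
  · apply Costs.bind
    · exact Costs.foldT (T := 1) (I := fun _ _ => True) (fun x xs b _ =>
        Costs.bind (T₂ := 0) Costs.tick fun _ _ => Costs.pure True.intro) True.intro
    intro c _
    apply Costs.bind (T₂ := 0)
    · exact Costs.mapT (T := 1) (R := fun x y : Factor => y.idx.Perm x.idx) fun x _ =>
        Costs.bind (T₂ := 0) Costs.tick fun _ _ => Costs.pure (.refl _)
    intro m hm
    exact Costs.pure ⟨hm.length_eq.symm, word_perm_of_forall₂ hm⟩
  · omega

/-! ### Branches -/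

/-- The index word of all R-factors of a branch. -/
def Branch.indices (B : Branch) : List Idx := word (B.qf ++ B.qd)

/-- A branch of at most `n` R-factors in which every index that is not free occurs twice. -/
def Branch.Ok (n : ℕ) (B : Branch) : Prop :=
  B.qf.length + B.qd.length ≤ n ∧ Paired B.indices

/-- The number of different open indices of a branch. -/
def Branch.opens (B : Branch) : ℕ := (openSet B.indices).card

theorem Branch.Ok.opens_le {n : ℕ} {B : Branch} (h : B.Ok n) : B.opens ≤ 2 * n := by
  have h1 := h.2.card_openSet
  rw [Branch.indices, length_word, List.length_append] at h1
  have h2 := h.1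
  rw [Branch.opens, Branch.indices]
  omega

theorem Costs.renameSeat (i : Idx) (k : ℕ) (j : Idx) :
    Costs (renameSeat i k j) 1 fun r => r = if j = i then .int k else j := by
  apply Costs.bind (T₂ := 0) Costs.tick
  intro _ _
  split_ifs <;> exact Costs.pure rfl

theorem Costs.renameFactor (i : Idx) (k : ℕ) (x : Factor) :
    Costs (renameFactor i k x) 11 fun y =>
      y.idx.Perm (x.idx.map fun j => if j = i then .int k else j) := by
  apply Costs.bind (T₁ := 1) (T₂ := 10) (Costs.renameSeat i k x.a)
  rintro a rfl
  apply Costs.bind (T₁ := 1) (T₂ := 9) (Costs.renameSeat i k x.b)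
  rintro b rfl
  apply Costs.bind (T₁ := 1) (T₂ := 8) (Costs.renameSeat i k x.c)
  rintro c rfl
  apply Costs.bind (T₁ := 1) (T₂ := 7) (Costs.renameSeat i k x.d)
  rintro d rfl
  exact Costs.sortFactor _

theorem Costs.rename {n : ℕ} {B : Branch} (hB : B.Ok n) {i : Idx} (hi : i.isFree = false) :
    Costs (B.rename i) (12 * n + 1) fun B' =>
      B'.Ok n ∧ ∀ j ∈ openSet B'.indices, j ∈ openSet B.indices ∧ j ≠ i := by
  rw [Branch.rename]
  apply Costs.le
  · apply Costs.bind (Costs.mapT fun x _ => Costs.renameFactor i B.next x)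
    intro qf hqf
    apply Costs.bind (Costs.mapT fun x _ => Costs.renameFactor i B.next x)
    intro qd hqd
    apply Costs.bind (T₂ := 0) Costs.tick
    intro _ _
    apply Costs.pure
    have hperm := (word_perm_map hqf).append (word_perm_map hqd)
    rw [← word_append, ← List.map_append, ← word_append] at hperm
    refine ⟨⟨?_, (hB.2.map fun j => ?_).perm hperm.symm⟩, fun j hj => ?_⟩
    · rw [← hqf.length_eq, ← hqd.length_eq]
      exact hB.1
    · split_ifs with h
      · rw [h, hi]
        rfl
      · rfl
    · obtain ⟨hj, ho⟩ := mem_openSet.mp hj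
      obtain ⟨j', hj', rfl⟩ := List.mem_map.mp (hperm.mem_iff.mp hj)
      split_ifs at ho ⊢ with h
      · cases ho
      · exact ⟨mem_openSet.mpr ⟨hj', ho⟩, h⟩
  · have := hB.1
    nlinarith

theorem Costs.renames {n : ℕ} {B : Branch} (hB : B.Ok n) {l : List Idx}
    (hl : ∀ i ∈ l, i.isFree = false) :
    Costs (B.renames l) (l.length * (12 * n + 2)) fun B' =>
      B'.Ok n ∧ ∀ j ∈ openSet B'.indices, j ∈ openSet B.indices ∧ j ∉ l := by
  refine (Costs.foldT (T := 12 * n + 1) (I := fun rem B' => (∀ i ∈ rem, i.isFree = false) ∧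
    B'.Ok n ∧ ∀ j ∈ openSet B'.indices, j ∈ openSet B.indices ∧ (j ∈ l → j ∈ rem))
    (fun x xs B' hB' => ?_) ⟨hl, hB, fun j hj => ⟨hj, id⟩⟩).imp fun B' hB' =>
      ⟨hB'.2.1, fun j hj => ⟨(hB'.2.2 j hj).1, fun h => ?_⟩⟩
  · refine (Costs.rename hB'.2.1 (hB'.1 x (by simp))).imp fun B'' hB'' =>
      ⟨fun i hi => hB'.1 i (by simp [hi]), hB''.1, fun j hj => ?_⟩
    obtain ⟨h1, h2⟩ := hB''.2 j hj
    refine ⟨(hB'.2.2 j h1).1, fun h => ?_⟩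
    exact List.mem_of_ne_of_mem h2 ((hB'.2.2 j h1).2 h)
  · cases (hB'.2.2 j hj).2 h

theorem Idx.isFree_of_isOpen {i : Idx} (h : i.isOpen = true) : i.isFree = false := by
  cases i <;> simp_all [Idx.isOpen, Idx.isFree]

theorem Costs.openIdx (seen l : List Idx) :
    Costs (openIdx seen l) (l.length * (2 + 2 * (seen.length + l.length))) fun r =>
      r.length ≤ l.length ∧ r.Nodup ∧ ∀ i, i ∈ r ↔ i ∈ l ∧ i.isOpen = true ∧ i ∉ seen := by
  induction l generalizing seen with
  | nil => exact (Costs.pure (by simp)).le (by simp)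
  | cons x xs ih =>
    rw [RiemCanon.openIdx]
    apply Costs.le (T := 1 + (1 + (seen.length * 2 +
      xs.length * (2 + 2 * (seen.length + 1 + xs.length)))))
    · apply Costs.bind Costs.tick
      intro _ _
      apply Costs.bind (Costs.inspect _ _)
      rintro b rfl
      have hskip : x.isOpen = false ∨ x ∈ seen →
          Costs (RiemCanon.openIdx seen xs) (xs.length * (2 + 2 * (seen.length + 1 + xs.length)))
          fun r => r.length ≤ (x :: xs).length ∧ r.Nodup ∧
            ∀ i, i ∈ r ↔ i ∈ x :: xs ∧ i.isOpen = true ∧ i ∉ seen := by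
        intro hx
        refine (ih seen).mono (by gcongr; omega) fun r hr => ?_
        refine ⟨hr.1.trans (by simp), hr.2.1, fun i => ?_⟩
        rw [hr.2.2, List.mem_cons]
        constructor
        · exact fun h => ⟨.inr h.1, h.2⟩
        · rintro ⟨rfl | h1, h2⟩
          · rcases hx with hx | hx
            · rw [hx] at h2
              cases h2.1
            · exact (h2.2 hx).elim
          · exact ⟨h1, h2⟩
      split_ifs with hx
      · apply Costs.bind (Costs.anyT (q := fun y => decide (x = y)) fun y _ => Costs.eqIdx x y)
        rintro b rfl
        split_ifs with hs
        · exact hskip (.inr (by simpa using hs))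
        · apply Costs.bind (T₂ := 0) (ih (x :: seen))
          intro r hr
          refine Costs.pure ⟨by simpa using hr.1, ?_, fun i => ?_⟩
          · rw [List.nodup_cons, hr.2.2]
            exact ⟨by simp, hr.2.1⟩
          · rw [List.mem_cons, hr.2.2]
            simp only [List.mem_cons, List.any_eq_true, decide_eq_true_eq, not_or, not_exists,
              not_and] at hs ⊢
            by_cases hix : i = x
            · subst hix
              simp only [true_or, hx, true_and, true_iff]
              exact fun h => hs i h rfl
            · simp [hix]
      · exact (hskip (.inl (by simpa using hx))).le (Nat.le_add_left _ _)
    · rw [List.length_cons]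
      nlinarith

theorem Costs.holder (i : Idx) (qf qd : List Factor) :
    Costs (holder i qf qd) (9 * (qf.length + qd.length)) fun _ => True := by
  have hany : ∀ x : Factor, Costs (RiemCanon.anyT (RiemCanon.eqIdx i) x.idx) 8
      fun b => b = x.idx.any fun j => decide (i = j) :=
    fun x => Costs.anyT fun j _ => Costs.eqIdx i j
  rw [RiemCanon.holder]
  apply Costs.le (T := qf.length * 9 + (qd.length * 9 + 0))
  · apply Costs.bind (Costs.findT fun x _ => hany x)
    intro r _
    cases r with
    | some r => exact (Costs.pure True.intro).le (Nat.zero_le _)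
    | none =>
      apply Costs.bind (T₂ := 0) (Costs.findT fun x _ => hany x)
      intro r _
      cases r <;> exact Costs.pure True.intro
  · omega

/-- Whatever the order of renaming, each of the branches produced has lost the two open indices
`i` and `j`. The open indices are counted against a set `S` containing those of the branch. -/
theorem Costs.branchOn {n : ℕ} {B : Branch} (hB : B.Ok n) (p : Mono) (pos : ℕ) {i j : Idx}
    (hij : i ≠ j) {S : Finset Idx} (hS : openSet B.indices ⊆ S) (hi : i ∈ S) (hj : j ∈ S)
    (hfi : i.isFree = false) (hfj : j.isFree = false) :
    Costs (branchOn p B pos i j) (100 * (n + 1)) fun r =>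
      (r.1.Ok n ∧ r.1.opens + 2 ≤ S.card) ∧
        (r.2 = [] ∨ ∃ B', r.2 = [B'] ∧ B'.Ok n ∧ B'.opens + 2 ≤ S.card) := by
  have hren : ∀ l, (l = [i, j] ∨ l = [j, i]) →
      Costs (B.renames l) (24 * n + 4) fun B' => B'.Ok n ∧ B'.opens + 2 ≤ S.card := by
    intro l hl
    have hl2 : l.length = 2 := by rcases hl with rfl | rfl <;> rfl
    have hmem : ∀ k, k ∈ l ↔ k = i ∨ k = j := by
      rcases hl with rfl | rfl
      · simp
      · simp [or_comm]
    refine (Costs.renames hB (l := l) fun k hk => ?_).mono (by rw [hl2]; omega) fun B' hB' =>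
      ⟨hB'.1, ?_⟩
    · rcases (hmem k).mp hk with rfl | rfl
      · exact hfi
      · exact hfj
    · have hsub : openSet B'.indices ⊆ S \ {i, j} := by
        intro k hk
        obtain ⟨h1, h2⟩ := hB'.2 k hk
        rw [hmem] at h2
        simp only [Finset.mem_sdiff, Finset.mem_insert, Finset.mem_singleton]
        exact ⟨hS h1, h2⟩
      have h1 := Finset.card_le_card hsub
      have hpair : ({i, j} : Finset Idx) ⊆ S := by
        intro k hk
        simp only [Finset.mem_insert, Finset.mem_singleton] at hk
        rcases hk with rfl | rfl
        · exact hi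
        · exact hj
      have h2 := Finset.card_sdiff_add_card_eq_card hpair
      rw [Finset.card_pair hij] at h2
      rw [Branch.opens]
      omega
  have hA := fun l hl => Costs.bind (T₂ := 0) (Q := fun r : Branch × List Branch =>
      (r.1.Ok n ∧ r.1.opens + 2 ≤ S.card) ∧
        (r.2 = [] ∨ ∃ B', r.2 = [B'] ∧ B'.Ok n ∧ B'.opens + 2 ≤ S.card))
    (f := fun B' => Pure.pure (B', [])) (hren l hl) fun B' hB' => Costs.pure ⟨hB', .inl rfl⟩
  have hC : Costs (do
      let B' ← B.renames [i, j]
      let B'' ← B.renames [j, i]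
      if ← RiemCanon.exceeds (word B''.qf) (word p.factors) then Pure.pure (B', [])
        else Pure.pure (B', [B'']))
      (56 * n + 8) fun r : Branch × List Branch =>
        (r.1.Ok n ∧ r.1.opens + 2 ≤ S.card) ∧
          (r.2 = [] ∨ ∃ B', r.2 = [B'] ∧ B'.Ok n ∧ B'.opens + 2 ≤ S.card) := by
    apply Costs.le (T := 24 * n + 4 + (24 * n + 4 + (8 * n + 0)))
    · apply Costs.bind (hren _ (.inl rfl))
      intro B' hB'
      apply Costs.bind (hren _ (.inr rfl))
      intro B'' hB''
      apply Costs.bind ((Costs.exceeds _ _).le _)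
      · intro b _
        split_ifs
        · exact Costs.pure ⟨hB', .inl rfl⟩
        · exact Costs.pure ⟨hB', .inr ⟨B'', rfl, hB''⟩⟩
      · have := hB''.1.1
        rw [length_word]
        omega
    · omega
  have hlen := hB.1
  rw [RiemCanon.branchOn]
  apply Costs.le (T := n + (9 * n + (9 * n + (4 + (56 * n + 8)))))
  · apply Costs.bind (Costs.tick.le (by omega))
    intro _ _
    have hsub : (B.qf.eraseIdx pos).length ≤ B.qf.length := List.length_eraseIdx_le _ _
    apply Costs.bind ((Costs.holder _ _ _).le (by omega))
    intro hi _
    apply Costs.bind ((Costs.holder _ _ _).le (by omega))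
    intro hj _
    have hA₁ := (hA _ (.inl rfl)).le (T' := 56 * n + 8) (by omega)
    have hA₂ := (hA _ (.inr rfl)).le (T' := 56 * n + 8) (by omega)
    split
    · apply Costs.bind (T₁ := 4) (Costs.cmpWord _ _)
      intro o _
      split_ifs
      · exact hA₁
      · exact hA₂
      · exact hC
    · exact hC.le (Nat.le_add_left _ _)
  · omega

/-- Nothing is left to be done in a branch whose placed R-factors have fixed indices only and
whose remaining R-factors have open indices only. -/
def Branch.Done (B : Branch) : Prop :=
  (∀ i ∈ word B.qf, i.isOpen = false) ∧ ∀ i ∈ word B.qd, i.isOpen = true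

/-- A step either finishes the branch, or removes an open index, or removes two open indices and
splits the branch in two. -/
theorem Costs.serStep {n : ℕ} {B : Branch} (hB : B.Ok n) (p : Mono) :
    Costs (serStep p B) (300 * (n + 1) ^ 2) fun r => r.1.Ok n ∧
      ((r.2 = [] ∧ (r.1.Done ∨ r.1.opens + 1 ≤ B.opens)) ∨
        ∃ B', r.2 = [B'] ∧ B'.Ok n ∧ r.1.opens + 2 ≤ B.opens ∧ B'.opens + 2 ≤ B.opens) := by
  have hlen := hB.1
  rw [RiemCanon.serStep]
  apply Costs.le (T := 9 * n + (8 * n + (6 * n ^ 2 + (n + (9 * n + (12 + (20 + (2 * (12 * n + 2) +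
    100 * (n + 1)))))))))
  · apply Costs.bind ((Costs.partitionT fun x _ => Costs.hasFixed x).le (by omega))
    rintro wr rfl
    set q : Factor → Bool := fun x => x.idx.any fun i => !i.isOpen
    have hpart := (List.filter_append_perm q B.qd).length_eq
    rw [List.length_append] at hpart
    apply Costs.bind ((Costs.mapT fun x _ => Costs.sortFactor x).le (by simp only; omega))
    intro w₁ hw₁
    have hw₁len : w₁.length = (B.qd.filter q).length := hw₁.length_eq.symm
    apply Costs.bind ((Costs.sortFactors w₁).le (by gcongr; omega))
    intro w hw
    have hwlen := hw.length_eq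
    apply Costs.bind (Costs.appendT.le (by omega))
    rintro _ rfl
    have hwperm : (word w).Perm (word (B.qd.filter q)) :=
      (word_perm hw).trans (word_perm_of_forall₂ hw₁)
    have hperm : (word ((B.qf ++ w) ++ B.qd.filter fun x => !q x)).Perm B.indices := by
      rw [Branch.indices, List.append_assoc, word_append, word_append, word_append]
      refine List.Perm.append_left _ ((hwperm.append_right _).trans ?_)
      rw [← word_append]
      exact word_perm (List.filter_append_perm q B.qd)
    have hB₁ : Branch.Ok n ⟨B.next, B.qf ++ w, B.qd.filter fun x => !q x⟩ := by
      refine ⟨?_, hB.2.perm hperm.symm⟩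
      simp only [List.length_append]
      omega
    have hopen : openSet (Branch.indices ⟨B.next, B.qf ++ w, B.qd.filter fun x => !q x⟩) =
        openSet B.indices := openSet_perm hperm
    apply Costs.bind ((Costs.findT fun x _ => Costs.hasOpen x).le (by
      rw [List.length_append]
      omega))
    rintro (_ | ⟨pos, x⟩) hx
    · refine (Costs.pure ⟨hB₁, .inl ⟨rfl, .inl ⟨fun i hi => ?_, fun i hi => ?_⟩⟩⟩).le
        (Nat.zero_le _)
      · obtain ⟨x, hxm, hi⟩ := mem_word.mp hi
        have := hx x hxm
        rw [List.any_eq_false] at this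
        simpa using this i hi
      · obtain ⟨x, hxm, hi⟩ := mem_word.mp hi
        have := (List.mem_filter.mp hxm).2
        simp only [Bool.not_eq_true', List.any_eq_false] at this
        simpa using this i hi
    · obtain ⟨hxm, hxo, -⟩ := hx
      have hmem : ∀ i ∈ x.idx, i.isOpen = true → i ∈ openSet B.indices := fun i hi ho => by
        rw [← hopen]
        refine mem_openSet.mpr ⟨mem_word.mpr ⟨x, ?_, hi⟩, ho⟩
        exact List.mem_append_left _ hxm
      apply Costs.bind (T₁ := 12) (Costs.openIdx [] [x.a, x.b])
      intro u hu
      apply Costs.bind ((Costs.openIdx u [x.c, x.d]).le _)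
      · intro v hv
        have hufree : ∀ i ∈ u, i.isFree = false := fun i hi =>
          Idx.isFree_of_isOpen ((hu.2.2 i).mp hi).2.1
        have hvfree : ∀ i ∈ v, i.isFree = false := fun i hi =>
          Idx.isFree_of_isOpen ((hv.2.2 i).mp hi).2.1
        apply Costs.bind ((Costs.renames hB₁ hufree).le (Nat.mul_le_mul_right _ hu.1))
        intro B₂ hB₂
        rw [hopen] at hB₂
        have hsub : openSet B₂.indices ⊆ openSet B.indices := fun k hk => (hB₂.2 k hk).1
        split
        · rename_i i j
          have hij : i ≠ j := by
            have := hv.2.1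
            simp only [List.nodup_cons, List.mem_singleton] at this
            exact this.1
          have hbranch : ∀ k ∈ [i, j], k ∈ openSet B.indices := by
            intro k hk
            obtain ⟨h1, h2, -⟩ := (hv.2.2 k).mp hk
            exact hmem k (List.mem_append_right [x.a, x.b] h1) h2
          refine (Costs.branchOn hB₂.1 p pos hij hsub (hbranch i (by simp))
            (hbranch j (by simp)) (hvfree i (by simp)) (hvfree j (by simp))).imp
              fun r hr => ⟨hr.1.1, ?_⟩
          have h1 : r.1.opens + 2 ≤ B.opens := hr.1.2
          rcases hr.2 with h | ⟨B', h, h2, h3⟩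
          · exact .inl ⟨h, .inr (by omega)⟩
          · exact .inr ⟨B', h, h2, h1, h3⟩
        · apply Costs.le
          · apply Costs.bind (T₂ := 0) (Costs.renames hB₂.1 hvfree)
            intro B₃ hB₃
            refine Costs.pure ⟨hB₃.1, .inl ⟨rfl, .inr ?_⟩⟩
            obtain ⟨i, hi, ho⟩ := List.any_eq_true.mp hxo
            refine Nat.succ_le_of_lt (Finset.card_lt_card ?_)
            refine (Finset.ssubset_iff_of_subset fun k hk => hsub (hB₃.2 k hk).1).mpr
              ⟨i, hmem i hi ho, fun h => ?_⟩
            obtain ⟨h1, h2⟩ := hB₃.2 i h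
            have h3 := (hB₂.2 i h1).2
            rw [hv.2.2] at h2
            rw [hu.2.2] at h3
            simp only [Factor.idx, List.mem_cons, List.not_mem_nil, or_false, not_false_iff,
              and_true, ho, true_and] at hi h2 h3
            rw [hu.2.2] at h2
            simp only [List.mem_cons, List.not_mem_nil, or_false, not_false_iff,
              and_true, ho] at h2
            tauto
          · have := hv.1
            simp only [List.length_cons, List.length_nil] at this
            nlinarith
      · have := hu.1
        simp only [List.length_cons, List.length_nil] at this ⊢
        omega
  · nlinarith

/-! ### Pre-normal forms -/

/-- An iteration in which every round takes at most `A` operations and lowers `μ`. -/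
theorem Costs.loop_of_decreasing {β σ : Type} {body : σ → Alg (σ ⊕ β)} {A : ℕ} {μ : σ → ℕ}
    {I : σ → Prop} {Q : β → Prop}
    (hbody : ∀ s, I s → Costs (body s) A fun r =>
      match r with
      | .inl s' => I s' ∧ μ s' < μ s
      | .inr b => Q b) {s : σ} (hs : I s) :
    Costs (RiemCanon.loop body s) (A * (μ s + 1)) Q := by
  refine Costs.loop (fun s hs => Runs.mono (hbody s hs) ?_) hs
  rintro (s' | b) k ⟨hk, hr⟩
  · exact ⟨hr.1, 1, le_rfl, hr.2, by simpa using hk⟩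
  · exact ⟨hr, hk.trans (Nat.le_mul_of_pos_right _ (Nat.succ_pos _))⟩

/-- A bound for the number of rounds spent on a branch with `D` open indices and on its
descendants. -/
def roundBound : ℕ → ℕ
  | 0 => 1
  | 1 => 2
  | D + 2 => 1 + 2 * roundBound D

theorem roundBound_pos (D : ℕ) : 0 < roundBound D := by
  match D with
  | 0 => exact Nat.one_pos
  | 1 => exact Nat.two_pos
  | D + 2 => rw [roundBound]; omega

theorem roundBound_lt_succ (D : ℕ) : roundBound D < roundBound (D + 1) := by
  match D with
  | 0 => decide
  | 1 => decide
  | D + 2 =>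
    rw [roundBound, roundBound]
    have := roundBound_lt_succ D
    omega

theorem roundBound_strictMono : StrictMono roundBound :=
  strictMono_nat_of_lt_succ roundBound_lt_succ

theorem roundBound_even (n : ℕ) : roundBound (2 * n) + 1 = 2 ^ (n + 1) := by
  induction n with
  | zero => rfl
  | succ n ih =>
    rw [show 2 * (n + 1) = 2 * n + 2 by ring, roundBound, pow_succ, ← ih]
    ring

theorem Branch.Ok.roundBound_le {n : ℕ} {B : Branch} (h : B.Ok n) :
    roundBound B.opens ≤ 2 ^ (n + 1) := by
  have h1 := roundBound_strictMono.monotone h.opens_le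
  have h2 := roundBound_even n
  omega

/-- A monomial with at most `n` R-factors in which every index that is not free occurs twice. -/
def Mono.Ok (n : ℕ) (p : Mono) : Prop :=
  p.factors.length ≤ n ∧ Paired (word p.factors)

/-- The total number of rounds that the branches waiting in a state can take. -/
def PnomState.rounds (s : PnomState) : ℕ :=
  (s.queue.map fun B => roundBound B.opens).sum

/-- The minimum and the branches of a state are well-formed. -/
def PnomState.Ok (n : ℕ) (s : PnomState) : Prop :=
  s.p.Ok n ∧ ∀ B ∈ s.queue, B.Ok n

/-- A round takes polynomial time and lowers the potential: a continued branch has fewer open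
indices, or two branches with two open indices less replace the current one. -/
theorem Costs.serIdx {n : ℕ} {s : PnomState} (hs : s.Ok n) :
    Costs (serIdx s) (400 * (n + 1) ^ 2) fun r =>
      match r with
      | .inl s' => s'.Ok n ∧ s'.rounds < s.rounds
      | .inr p => p.Ok n := by
  obtain ⟨K, p, queue⟩ := s
  obtain ⟨hp, hqueue⟩ := hs
  rw [RiemCanon.serIdx]
  apply Costs.le (T := 1 + (300 * (n + 1) ^ 2 + (8 * n + (0 + (9 * n + (9 * n +
    (0 + (4 * n + (0 + (4 * n + (1 + 0)))))))))))
  · apply Costs.bind Costs.tick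
    intro _ _
    rcases queue with _ | ⟨B, rest⟩
    · refine (Costs.pure ?_).le (Nat.zero_le _)
      exact hp
    apply Costs.bind (Costs.serStep (hqueue B (by simp)) p)
    rintro ⟨B', bs⟩ ⟨hB', hr⟩
    simp only at hr hB' ⊢
    have hrest : ∀ B'' ∈ rest ++ bs, B''.Ok n := by
      intro B'' hB''
      rcases List.mem_append.mp hB'' with h | h
      · exact hqueue B'' (by simp [h])
      · rcases hr with ⟨rfl, -⟩ | ⟨B₁, rfl, h1, -⟩
        · cases h
        · rw [List.mem_singleton.mp h]
          exact h1
    have hlt : ((rest ++ bs).map fun B => roundBound B.opens).sum <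
        ((B :: rest).map fun B => roundBound B.opens).sum := by
      rcases hr with ⟨rfl, -⟩ | ⟨B₁, rfl, -, -, h2⟩
      · simpa using roundBound_pos _
      · have := roundBound_strictMono (show B₁.opens < B.opens by omega)
        simp only [List.map_append, List.sum_append, List.map_cons, List.map_nil, List.sum_cons,
          List.sum_nil]
        omega
    have hlen := hB'.1
    apply Costs.bind ((Costs.exceeds _ _).le (by rw [length_word]; omega))
    intro _ _
    apply Costs.ite
    · intro _
      exact Costs.pure ⟨⟨hp, hrest⟩, hlt⟩
    intro _
    apply Costs.bind ((Costs.anyT fun x _ => Costs.hasFixed x).le (by omega))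
    rintro u rfl
    apply Costs.bind ((Costs.anyT fun x _ => Costs.hasOpen x).le (by omega))
    rintro v rfl
    apply Costs.ite
    · intro huv
      refine Costs.pure ⟨⟨hp, List.forall_mem_cons.mpr ⟨hB', hrest⟩⟩, ?_⟩
      simp only [PnomState.rounds, List.map_append, List.sum_append, List.map_cons, List.sum_cons]
      rcases hr with ⟨rfl, hdone | h⟩ | ⟨B₁, rfl, -, h1, h2⟩
      · exfalso
        rw [Bool.or_eq_true, List.any_eq_true, List.any_eq_true] at huv
        rcases huv with ⟨x, hx, hi⟩ | ⟨x, hx, hi⟩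
        · obtain ⟨i, hi, ho⟩ := List.any_eq_true.mp hi
          rw [hdone.2 i (mem_word.mpr ⟨x, hx, hi⟩)] at ho
          cases ho
        · obtain ⟨i, hi, ho⟩ := List.any_eq_true.mp hi
          rw [hdone.1 i (mem_word.mpr ⟨x, hx, hi⟩)] at ho
          cases ho
      · have := roundBound_strictMono (show B'.opens < B.opens by omega)
        simp only [List.map_nil, List.sum_nil]
        omega
      · have h3 := roundBound_strictMono.monotone h1
        have h4 := roundBound_strictMono.monotone h2
        simp only [List.map_cons, List.map_nil, List.sum_cons, List.sum_nil]
        rw [roundBound] at h3 h4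
        omega
    intro huv
    apply Costs.bind ((Costs.collect _).le (by omega))
    intro q hq
    -- an integer in the placed R-factors of a finished branch occurs in no other R-factor
    have hqok : q.Ok n := by
      refine ⟨by omega, Paired.perm ?_ hq.2.symm⟩
      intro i hi hf
      rw [Bool.or_eq_true, not_or, List.any_eq_true, List.any_eq_true] at huv
      have hfixed : i.isOpen = false := by
        obtain ⟨x, hx, hix⟩ := mem_word.mp hi
        by_contra ho
        exact huv.2 ⟨x, hx, List.any_eq_true.mpr ⟨i, hix, by simpa using ho⟩⟩
      have hnot : i ∉ word B'.qd := by
        intro h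
        obtain ⟨x, hx, hix⟩ := mem_word.mp h
        exact huv.1 ⟨x, hx, List.any_eq_true.mpr ⟨i, hix, by simpa using hfixed⟩⟩
      have h2 := hB'.2 i (by
        rw [Branch.indices, word_append]
        exact List.mem_append_left _ hi) hf
      rwa [Branch.indices, word_append, List.count_append, List.count_eq_zero_of_not_mem hnot,
        add_zero] at h2
    apply Costs.ite
    · intro _
      exact Costs.pure ⟨⟨hqok, hrest⟩, hlt⟩
    intro _
    apply Costs.bind ((Costs.cmpWord _ _).le (by rw [length_word]; omega))
    intro o _
    cases o
    · exact (Costs.pure ⟨⟨hqok, hrest⟩, hlt⟩).le (Nat.zero_le _)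
    · apply Costs.bind Costs.tick
      intro _ _
      split_ifs
      · exact Costs.pure ⟨Nat.zero_le _, fun i hi => by cases hi⟩
      · exact Costs.pure ⟨⟨hp, hrest⟩, hlt⟩
    · exact (Costs.pure ⟨⟨hp, hrest⟩, hlt⟩).le (Nat.zero_le _)
  · nlinarith

theorem Costs.serIdx_loop {n m : ℕ} {p : Mono} (hp : p.Ok n) {bs : List Branch}
    (hbs : ∀ B ∈ bs, B.Ok n) (hlen : bs.length ≤ m) :
    Costs (RiemCanon.loop RiemCanon.serIdx ⟨1, p, bs⟩) (400 * (n + 1) ^ 2 * (m * 2 ^ (n + 1) + 1))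
      fun q => q.Ok n := by
  have hstate : PnomState.Ok n ⟨1, p, bs⟩ := ⟨hp, hbs⟩
  refine (Costs.loop_of_decreasing (μ := PnomState.rounds) (I := PnomState.Ok n)
    (fun s hs => (Costs.serIdx hs).imp (by rintro (s' | p) h <;> exact h)) hstate).le ?_
  gcongr
  calc (bs.map fun B => roundBound B.opens).sum ≤ bs.length * 2 ^ (n + 1) := by
        rw [← smul_eq_mul, ← List.length_map (f := fun B : Branch => roundBound B.opens)]
        refine List.sum_le_card_nsmul _ _ fun x hx => ?_
        obtain ⟨B, hB, rfl⟩ := List.mem_map.mp hx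
        exact (hbs B hB).roundBound_le
    _ ≤ m * 2 ^ (n + 1) := by gcongr

theorem Costs.loopSplit (x : Factor) : Costs (loopSplit x) 3 fun r =>
    r.1 ∈ x.idx ∧ r.2.1 ∈ x.idx ∧ r.2.2 ∈ x.idx := by
  have ha : x.a ∈ x.idx := by simp [Factor.idx]
  have hb : x.b ∈ x.idx := by simp [Factor.idx]
  have hc : x.c ∈ x.idx := by simp [Factor.idx]
  have hd : x.d ∈ x.idx := by simp [Factor.idx]
  apply Costs.le (T := 1 + (0 + (1 + (0 + (1 + (0 + 0))))))
  · apply Costs.bind (Costs.eqIdx _ _)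
    intro _ _
    apply Costs.ite
    · exact fun _ => Costs.pure ⟨ha, hb, hd⟩
    intro _
    apply Costs.bind (Costs.eqIdx _ _)
    intro _ _
    apply Costs.ite
    · exact fun _ => Costs.pure ⟨ha, hb, hc⟩
    intro _
    apply Costs.bind (Costs.eqIdx _ _)
    intro _ _
    apply Costs.ite
    · exact fun _ => Costs.pure ⟨hb, ha, hd⟩
    · exact fun _ => Costs.pure ⟨hb, ha, hc⟩
  · rfl

/-- The properties of a list of renaming orders for the leading R-factor that bound the cost. -/
def OrdersOf (x : Factor) (ls : List (List Idx)) : Prop :=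
  ls.length ≤ 24 ∧ ∀ l ∈ ls, l.length ≤ 4 ∧ ∀ i ∈ l, i ∈ x.idx

theorem Costs.ricciOrders (x : Factor) : Costs (ricciOrders x) 100 (OrdersOf x) := by
  apply Costs.le (T := 3 + (6 + 0))
  · apply Costs.bind (Costs.loopSplit x)
    rintro ⟨i, j, k⟩ ⟨hi, hj, hk⟩
    apply Costs.bind Costs.tick
    intro _ _
    refine Costs.pure ⟨by simp, ?_⟩
    simp_all
  · norm_num

theorem Costs.completeOrders (x : Factor) : Costs (completeOrders x) 100 (OrdersOf x) := by
  apply Costs.le (T := 96 + 0)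
  · apply Costs.bind Costs.tick
    intro _ _
    refine Costs.pure ⟨?_, fun l hl => ?_⟩
    · rw [List.length_permutations]
      exact le_of_eq rfl
    · have h := List.mem_permutations.mp hl
      exact ⟨h.length_eq.le, fun i hi => h.mem_iff.mp hi⟩
  · norm_num

/-- Each starting branch consists of all R-factors of `before ++ l`, in which at most four indices
are renamed. -/
theorem Costs.startBranches {n : ℕ} {orders : Factor → Alg (List (List Idx))}
    (horders : ∀ x, Costs (orders x) 100 (OrdersOf x)) {before l : List Factor}
    (hlen : before.length + l.length ≤ n) (hpaired : Paired (word (before ++ l)))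
    (hfree : ∀ x ∈ l, ∀ i ∈ x.idx, i.isFree = false) :
    Costs (startBranches orders before l) (l.length * (400 + 1200 * n)) fun bs =>
      bs.length ≤ 24 * l.length ∧ ∀ B ∈ bs, B.Ok n := by
  induction l generalizing before with
  | nil => exact (Costs.pure (by simp)).le (Nat.zero_le _)
  | cons x after ih =>
    rw [List.length_cons] at hlen
    rw [RiemCanon.startBranches]
    apply Costs.le (T := 1 + (100 + (n + (24 * (4 * (12 * n + 2) + 1) + (n +
      (after.length * (400 + 1200 * n) + 24))))))
    · apply Costs.bind Costs.tick
      intro _ _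
      apply Costs.bind (horders x)
      intro ls hls
      apply Costs.bind (Costs.appendT.le (by omega))
      rintro _ rfl
      have hperm : (word (before ++ x :: after)).Perm
          (Branch.indices ⟨1, [x], before ++ after⟩) :=
        word_perm List.perm_middle
      have hstart : Branch.Ok n ⟨1, [x], before ++ after⟩ := by
        refine ⟨?_, hpaired.perm hperm⟩
        simp only [List.length_append, List.length_singleton]
        omega
      have hbs : Costs (RiemCanon.mapT (startBranch x (before ++ after)) ls)
          (24 * (4 * (12 * n + 2) + 1)) fun bs => bs.length ≤ 24 ∧ ∀ B ∈ bs, B.Ok n := by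
        refine (Costs.mapT (T := 4 * (12 * n + 2)) (R := fun _ B => B.Ok n) fun l hl =>
          ((Costs.renames hstart fun i hi => ?_).mono ?_ fun B hB => hB.1)).mono ?_ fun bs hbs =>
            ⟨hbs.length_eq ▸ hls.1, fun B hB => ?_⟩
        · exact hfree x (by simp) i ((hls.2 l hl).2 i hi)
        · exact Nat.mul_le_mul_right _ (hls.2 l hl).1
        · exact Nat.mul_le_mul_right _ hls.1
        · obtain ⟨_, -, h⟩ := exists_mem_left_of_forall₂ hbs hB
          exact h
      apply Costs.bind hbs
      intro bs hbs
      apply Costs.bind (Costs.appendT.le (by omega))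
      rintro _ rfl
      apply Costs.bind (ih (before := before ++ [x])
        (by simp only [List.length_append, List.length_singleton]; omega)
        (by simpa using hpaired) fun y hy => hfree y (by simp [hy]))
      intro r hr
      refine Costs.appendT.mono hbs.1 ?_
      rintro _ rfl
      refine ⟨?_, fun B hB => ?_⟩
      · rw [List.length_append, List.length_cons]
        have h1 := hr.1
        have h2 := hbs.1
        omega
      · rcases List.mem_append.mp hB with h | h
        · exact hbs.2 B h
        · exact hr.2 B h
    · rw [List.length_cons, add_mul, one_mul]
      omega

/-- No index of the word is an integer. -/
def NoInt (w : List Idx) : Prop :=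
  ∀ i ∈ w, i.isFree = true ∨ i.isOpen = true

/-- Each of the at most `24 n` starting branches has at most `2 n` open indices, which bounds the
number of rounds. -/
theorem Costs.pnom {n : ℕ} {f : List Factor} (hlen : f.length ≤ n) (hpaired : Paired (word f))
    (hint : NoInt (word f)) :
    Costs (pnom f) (30000 * (n + 1) ^ 3 * 2 ^ n) fun p => p.Ok n := by
  obtain ⟨q, hq⟩ := Costs.exists_eq Costs.vanishes
  obtain ⟨q', hq'⟩ := Costs.exists_eq Costs.hasLoop
  set L := 400 * (n + 1) ^ 2 * (24 * n * 2 ^ (n + 1) + 1) with hL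
  set S := n * (400 + 1200 * n) with hS
  rw [RiemCanon.pnom]
  apply Costs.le (T := 8 * n + (3 * n + (0 + (9 * n + (6 * n ^ 2 + (33 * n + (9 * n +
    (4 * n + (4 * n + (n + (S + (400 * (n + 1) ^ 2 * (1 * 2 ^ (n + 1) + 1) + L))))))))))))
  · apply Costs.bind ((Costs.mapT fun x _ => Costs.sortFactor x).le (by omega))
    intro g hg
    have hglen := hg.length_eq
    have hgperm := word_perm_of_forall₂ hg
    apply Costs.bind ((Costs.anyT fun x _ => hq x).le (by omega))
    intro _ _
    apply Costs.ite
    · exact fun _ => Costs.pure ⟨Nat.zero_le _, fun i hi => by cases hi⟩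
    intro _
    obtain ⟨fr, hfr⟩ : ∃ fr : Factor → Bool, fr = fun x => x.idx.any Idx.isFree := ⟨_, rfl⟩
    apply Costs.bind ((Costs.partitionT (q := fr) fun x _ => by
      rw [hfr]
      exact Costs.hasFree x).le (by omega))
    rintro ed rfl
    have hpart := List.filter_append_perm fr g
    have hpartlen := hpart.length_eq
    rw [List.length_append] at hpartlen
    apply Costs.bind ((Costs.sortFactors _).le (by gcongr; simp only; omega))
    intro e he
    simp only at he
    have helen := he.length_eq
    apply Costs.bind ((Costs.partitionT fun x _ => hq' x).le (by simp only; omega))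
    rintro lc rfl
    simp only
    have hpart' := List.filter_append_perm q' (g.filter fun x => !fr x)
    generalize (g.filter fun x => !fr x).filter q' = l at hpart' ⊢
    generalize (g.filter fun x => !fr x).filter (fun x => !q' x) = c at hpart' ⊢
    have hpartlen' := hpart'.length_eq
    rw [List.length_append] at hpartlen'
    apply Costs.bind ((Costs.anyT fun x _ => Costs.hasOpen x).le (by omega))
    rintro so rfl
    apply Costs.ite
    · -- without open indices and integers all indices are free, and `Paired` holds trivially
      intro hso
      refine (Costs.collect e).mono (by omega) fun p hp => ⟨by omega, ?_⟩
      intro i hi hf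
      exfalso
      obtain ⟨x, hx, hix⟩ := mem_word.mp (hp.2.mem_iff.mp hi)
      have hxg : x ∈ g := (List.mem_filter.mp (he.mem_iff.mp hx)).1
      rcases hint i (hgperm.mem_iff.mp (mem_word.mpr ⟨x, hxg, hix⟩)) with h | h
      · rw [hf] at h
        cases h
      · rw [Bool.not_eq_true', List.any_eq_false] at hso
        exact hso x hxg (List.any_eq_true.mpr ⟨i, hix, h⟩)
    intro _
    apply Costs.bind ((Costs.collect g).le (by omega))
    intro p hp
    have hpok : p.Ok n := ⟨by omega, hpaired.perm (hp.2.trans hgperm).symm⟩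
    match e, l, he, helen, hpart', hpartlen' with
    | x :: e, l, he, helen, hpart', hpartlen' =>
      apply Costs.bind (Costs.appendT.le (by omega))
      rintro _ rfl
      refine (Costs.serIdx_loop (m := 1) hpok (fun B hB => ?_) le_rfl).le
        (by rw [hS, hL]; omega)
      rw [List.mem_singleton.mp hB]
      refine ⟨by simp only [List.length_append]; omega, ?_⟩
      exact hpaired.perm (hgperm.symm.trans (word_perm ((he.append hpart').trans hpart).symm))
    | [], l, he, helen, hpart', hpartlen' =>
      have hnone : g.filter fr = [] := he.nil_eq.symm
      rw [hnone, List.nil_append] at hpart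
      have hperm := word_perm (hpart'.trans hpart)
      have hfree : ∀ x ∈ l ++ c, ∀ i ∈ x.idx, i.isFree = false := by
        intro x hx i hi
        have := (List.mem_filter.mp (hpart'.mem_iff.mp hx)).2
        rw [hfr, Bool.not_eq_true', List.any_eq_false] at this
        simpa using this i hi
      have hstart : ∀ (orders : Factor → Alg (List (List Idx))) (before l₁ : List Factor),
          (∀ x, Costs (orders x) 100 (OrdersOf x)) → (before ++ l₁).Perm (l ++ c) →
          Costs (do
            let bs ← RiemCanon.startBranches orders before l₁
            RiemCanon.loop RiemCanon.serIdx ⟨1, p, bs⟩) (S + L) fun p => p.Ok n := by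
        intro orders before l₁ horders hl₁
        have h1 := hl₁.length_eq
        simp only [List.length_append] at h1
        apply Costs.bind
        · refine (Costs.startBranches (n := n) horders (before := before) (l := l₁) (by omega) ?_
            fun x hx => hfree x (hl₁.mem_iff.mp (List.mem_append_right _ hx))).le ?_
          · exact hpaired.perm ((word_perm hl₁).trans (hperm.trans hgperm)).symm
          · exact Nat.mul_le_mul_right _ (by omega)
        · rintro bs ⟨hbs, hok⟩
          exact Costs.serIdx_loop hpok hok (hbs.trans (by omega))
      match l, hpart', hpartlen', hstart with
      | x :: l, hpart', hpartlen', hstart =>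
        apply Costs.le (T := 0 + (S + L))
        · apply Costs.ite
          · intro h1
            have hone : (ricciScalar x.coef).factors.length = 1 := rfl
            refine Costs.pure ⟨by omega, ?_⟩
            intro i hi _
            simp only [ricciScalar, word, Factor.idx, List.flatMap_cons, List.flatMap_nil,
              List.append_nil, List.mem_cons, List.not_mem_nil, or_false] at hi
            rcases hi with rfl | rfl | rfl | rfl <;> exact le_of_eq rfl
          · exact fun _ => hstart _ c (x :: l) Costs.ricciOrders List.perm_append_comm
        · omega
      | [], hpart', hpartlen', hstart =>
        exact (hstart _ [] c Costs.completeOrders (.refl _)).le (by omega)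
  · have h2 : 1 ≤ 2 ^ n := Nat.one_le_two_pow
    have h3 : n ≤ n * 2 ^ n := Nat.le_mul_of_pos_right _ h2
    rw [hS, hL, pow_succ 2 n]
    generalize 2 ^ n = P at *
    obtain ⟨P, rfl⟩ := Nat.exists_eq_add_of_le h2
    ring_nf
    nlinarith

/-- The left-hand side divided by `3 ^ n` is largest for `n = 6`, and decreases from there on. -/
theorem cube_mul_two_pow_le (n : ℕ) : (n + 1) ^ 3 * 2 ^ n ≤ 31 * 3 ^ n := by
  rcases lt_or_ge n 6 with h | h
  · interval_cases n <;> norm_num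
  · induction n, h using Nat.le_induction with
    | base => norm_num
    | succ n hn ih =>
      have h1 : 2 * (n + 1 + 1) ^ 3 ≤ 3 * (n + 1) ^ 3 := by
        obtain ⟨k, rfl⟩ := Nat.exists_eq_add_of_le hn
        ring_nf
        nlinarith
      calc (n + 1 + 1) ^ 3 * 2 ^ (n + 1) = 2 * (n + 1 + 1) ^ 3 * 2 ^ n := by ring
        _ ≤ 3 * (n + 1) ^ 3 * 2 ^ n := by gcongr
        _ = 3 * ((n + 1) ^ 3 * 2 ^ n) := by ring
        _ ≤ 3 * (31 * 3 ^ n) := by gcongr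
        _ = 31 * 3 ^ (n + 1) := by ring

theorem Costs.pnom_le {n : ℕ} {f : List Factor} (hlen : f.length ≤ n) (hpaired : Paired (word f))
    (hint : NoInt (word f)) : Costs (RiemCanon.pnom f) (930000 * 3 ^ n) fun p => p.Ok n := by
  refine (Costs.pnom hlen hpaired hint).le ?_
  have := cube_mul_two_pow_le n
  rw [mul_assoc]
  omega

/-! ### The extension -/

/-- A term of the extension of `l`: the indices within each R-factor are permuted. -/
def IsTerm (l : List Factor) (t : List Factor × List (ℕ × ℕ)) : Prop :=
  t.1.length = l.length ∧ (word t.1).Perm (word l) ∧ t.2.length ≤ l.length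

theorem Costs.mapT_eq {α β : Type} {f : α → Alg β} {g : α → β} {T : ℕ} {l : List α}
    (h : ∀ x ∈ l, Costs (f x) T fun y => y = g x) :
    Costs (RiemCanon.mapT f l) (l.length * (T + 1)) fun l' => l' = l.map g := by
  refine (Costs.mapT h).imp fun l' hl' => ?_
  induction hl' with
  | nil => rfl
  | cons hxy _ ih => rw [List.map_cons, hxy, ih fun z hz => h z (by simp [hz])]

theorem Costs.extension (i : ℕ) (l : List Factor) :
    Costs (extension i l) (37 * 3 ^ l.length) fun ts =>
      ts.length ≤ 3 ^ l.length ∧ ∀ t ∈ ts, IsTerm l t := by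
  induction l generalizing i with
  | nil =>
    refine (Costs.pure ⟨by simp, ?_⟩).le (Nat.zero_le _)
    simp [IsTerm, word]
  | cons x xs ih =>
    rw [RiemCanon.extension]
    set M := 3 ^ xs.length with hM
    apply Costs.le (T := 37 * M + (32 + (M + (M + (M + (M + (M + M)))))))
    · apply Costs.bind (ih (i + 1))
      rintro ts ⟨hlen, hts⟩
      have hterm : ∀ (y : Factor) (s : List (ℕ × ℕ)), y.idx.Perm x.idx → s.length ≤ 1 →
          ∀ t ∈ ts.map (fun t => (y :: t.1, s ++ t.2)), IsTerm (x :: xs) t := by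
        intro y s hy hs t' ht'
        obtain ⟨t, ht, rfl⟩ := List.mem_map.mp ht'
        obtain ⟨h1, h2, h3⟩ := hts t ht
        refine ⟨by simp [h1], hy.append h2, ?_⟩
        simp only [List.length_append, List.length_cons]
        omega
      have hmap : ∀ (y : Factor) (s : List (ℕ × ℕ)),
          Costs (RiemCanon.mapT (fun t => Pure.pure (y :: t.1, s ++ t.2)) ts) M
            fun r => r = ts.map fun t : List Factor × List (ℕ × ℕ) => (y :: t.1, s ++ t.2) :=
        fun y s => (Costs.mapT_eq (T := 0) fun t _ => Costs.pure rfl).le (by omega)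
      apply Costs.bind (Costs.hasLoop x)
      intro b _
      apply Costs.ite
      · intro _
        refine (hmap x []).imp ?_
        rintro _ rfl
        refine ⟨?_, hterm x [] (.refl _) (by simp)⟩
        rw [List.length_map, List.length_cons, pow_succ]
        omega
      · intro _
        apply Costs.bind (hmap x [(i, 0)])
        rintro _ rfl
        apply Costs.bind (hmap ⟨x.coef, x.a, x.c, x.d, x.b⟩ [(i, 1)])
        rintro _ rfl
        apply Costs.bind (hmap ⟨x.coef, x.a, x.d, x.b, x.c⟩ [(i, 2)])
        rintro _ rfl
        apply Costs.bind (Costs.appendT.le (by simpa using hlen))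
        rintro _ rfl
        refine Costs.appendT.mono (by simpa using hlen) ?_
        rintro _ rfl
        refine ⟨?_, ?_⟩
        · simp only [List.length_append, List.length_map, List.length_cons, pow_succ]
          omega
        · intro t ht
          rw [List.mem_append, List.mem_append] at ht
          rcases ht with ht | ht | ht
          · exact hterm x _ (.refl _) (by simp) t ht
          · refine hterm ⟨x.coef, x.a, x.c, x.d, x.b⟩ _ (.cons _ ?_) (by simp) t ht
            exact List.perm_append_comm (l₁ := [x.c, x.d]) (l₂ := [x.b])
          · refine hterm ⟨x.coef, x.a, x.d, x.b, x.c⟩ _ (.cons _ ?_) (by simp) t ht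
            exact List.perm_append_comm (l₁ := [x.d]) (l₂ := [x.b, x.c])
    · have : 1 ≤ M := Nat.one_le_pow _ _ (by norm_num)
      rw [List.length_cons, pow_succ]
      omega

/-- A list of at most `M` like-term combined entries with at most `S` terms in all, in which the
monomials have at most `n` R-factors and the products at most `n` parameters. -/
def EntriesOk (n M S : ℕ) (g : List Entry) : Prop :=
  g.length ≤ M ∧ (g.map fun e => e.coeff.length).sum ≤ S ∧
    ∀ e ∈ g, e.mono.length ≤ n ∧ ∀ t ∈ e.coeff, t.2.length ≤ n

theorem Costs.insertTerm {n M S : ℕ} {mo : List Factor} (hmo : mo.length ≤ n)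
    {t : ℚ × List (ℕ × ℕ)} (ht : t.2.length ≤ n) {g : List Entry} (hg : EntriesOk n M S g) :
    Costs (insertTerm mo t g) ((g.length + 1) * (4 * n + 1)) (EntriesOk n (M + 1) (S + 1)) := by
  induction g generalizing M S with
  | nil =>
    apply Costs.le (T := 1 + 0)
    · apply Costs.bind Costs.tick
      intro _ _
      exact Costs.pure ⟨by simp, by simp,
        List.forall_mem_singleton.mpr ⟨hmo, List.forall_mem_singleton.mpr ht⟩⟩
    · simp
  | cons e es ih =>
    rw [RiemCanon.insertTerm]
    obtain ⟨h1, h2, h3⟩ := hg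
    rw [List.length_cons] at h1
    rw [List.map_cons, List.sum_cons] at h2
    rw [List.forall_mem_cons] at h3
    apply Costs.le (T := 1 + (4 * n + (es.length + 1) * (4 * n + 1)))
    · apply Costs.bind Costs.tick
      intro _ _
      apply Costs.bind ((Costs.cmpWord _ _).le (by rw [length_word]; omega))
      intro o _
      cases o
      · apply Costs.bind (T₂ := 0) (ih ⟨le_rfl, le_rfl, h3.2⟩)
        rintro r ⟨h4, h5, h6⟩
        refine Costs.pure ⟨?_, ?_, List.forall_mem_cons.mpr ⟨h3.1, h6⟩⟩
        · rw [List.length_cons]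
          omega
        · rw [List.map_cons, List.sum_cons]
          omega
      · refine (Costs.pure ⟨?_, ?_, ?_⟩).le (Nat.zero_le _)
        · simp only [List.length_cons]
          omega
        · simp only [List.map_cons, List.sum_cons, List.length_cons]
          omega
        · rw [List.forall_mem_cons]
          exact ⟨⟨h3.1.1, List.forall_mem_cons.mpr ⟨ht, h3.1.2⟩⟩, h3.2⟩
      · refine (Costs.pure ⟨?_, ?_, ?_⟩).le (Nat.zero_le _)
        · simp only [List.length_cons]
          omega
        · simp only [List.map_cons, List.sum_cons, List.length_cons, List.length_nil]
          omega
        · exact List.forall_mem_cons.mpr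
            ⟨⟨hmo, List.forall_mem_singleton.mpr ht⟩, List.forall_mem_cons.mpr h3⟩
    · rw [List.length_cons]
      nlinarith

/-- The extension of a monomial of at most `n` R-factors has at most `3 ^ n` terms. -/
theorem Costs.pnomExtension {n : ℕ} {f : List Factor} (hlen : f.length ≤ n)
    (hpaired : Paired (word f)) (hint : NoInt (word f)) :
    Costs (pnomExtension f) (940000 * ((n + 1) * (3 ^ n * 3 ^ n)))
      (EntriesOk n (3 ^ n) (3 ^ n)) := by
  have hpow : 3 ^ f.length ≤ 3 ^ n := Nat.pow_le_pow_right (by norm_num) hlen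
  have hpos : 1 ≤ 3 ^ n := Nat.one_le_pow _ _ (by norm_num)
  rw [RiemCanon.pnomExtension]
  set M := 3 ^ n with hM
  apply Costs.le (T := 37 * M + M * (930000 * M + (0 + (M + 1) * (4 * n + 1)) + 1))
  · apply Costs.bind ((Costs.extension 0 f).le (Nat.mul_le_mul_left _ hpow))
    rintro ts ⟨hts, hterm⟩
    refine (Costs.foldT (T := 930000 * M + (0 + (M + 1) * (4 * n + 1)))
      (I := fun rem g => (∀ t ∈ rem, IsTerm f t) ∧ rem.length ≤ M ∧
        EntriesOk n (M - rem.length) (M - rem.length) g) ?_ ?_).mono ?_ fun g hg => hg.2.2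
    · rintro t rem g ⟨hrem, hrlen, hg⟩
      rw [List.length_cons] at hrlen hg
      rw [List.forall_mem_cons] at hrem
      obtain ⟨⟨h1, h2, h3⟩, hrem⟩ := hrem
      have hstep : M - (rem.length + 1) + 1 = M - rem.length := by omega
      apply Costs.bind (Costs.pnom_le (n := n) (by omega) (hpaired.perm h2.symm)
        fun i hi => hint i (h2.mem_iff.mp hi))
      intro p hp
      apply Costs.ite
      · intro _
        exact Costs.pure ⟨hrem, by omega, hg.1.trans (by omega), hg.2.1.trans (by omega), hg.2.2⟩
      · intro _
        refine (Costs.insertTerm (n := n) hp.1 (by simp only; omega) hg).mono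
          (Nat.mul_le_mul_right _ ?_) fun g' hg' => ⟨hrem, by omega, ?_⟩
        · have := hg.1
          omega
        · rwa [hstep] at hg'
    · refine ⟨hterm, hts.trans hpow, Nat.zero_le _, Nat.zero_le _, fun e he => by cases he⟩
    · exact Nat.mul_le_mul_right _ (hts.trans hpow)
  · nlinarith [Nat.mul_le_mul hpos hpos, Nat.zero_le (n * M), Nat.mul_le_mul_left (n * M) hpos,
      Nat.mul_le_mul_left M hpos]

/-! ### The coefficient matrix -/

theorem Costs.evalCoeff (k j : ℕ) {n : ℕ} {e : Entry} (he : ∀ t ∈ e.coeff, t.2.length ≤ n) :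
    Costs (evalCoeff k j e) (e.coeff.length * (2 * n + 2)) fun _ => True := by
  refine (Costs.foldT (T := 2 * n + 1) (I := fun rem _ => ∀ t ∈ rem, t ∈ e.coeff)
    (fun t rem v hrem => ?_) fun t => id).trivial
  rw [List.forall_mem_cons] at hrem
  have hprod : Costs (paramProduct k j t) (2 * n) fun _ => True := by
    refine (Costs.foldT (T := 1) (I := fun _ _ => True) (fun ij _ v _ => ?_) True.intro).mono ?_
      fun _ _ => True.intro
    · apply Costs.bind (T₂ := 0) Costs.tick
      intro _ _
      split_ifs <;> exact Costs.pure True.intro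
    · have := he t hrem.1
      omega
  apply Costs.bind hprod
  intro w _
  apply Costs.bind (T₂ := 0) Costs.tick
  intro _ _
  exact Costs.pure hrem.2

theorem Costs.bianchiRows (k : ℕ) {n M S : ℕ} {g : List Entry} (hg : EntriesOk n M S g) (j : ℕ)
    (l : List Factor) :
    Costs (bianchiRows k g j l) (l.length * (M + S * (2 * n + 2) + 33)) fun H =>
      H.length ≤ l.length ∧ ∀ r ∈ H, r.length = g.length := by
  induction l generalizing j with
  | nil => exact (Costs.pure (by simp)).le (Nat.zero_le _)
  | cons x xs ih =>
    rw [RiemCanon.bianchiRows]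
    apply Costs.le (T := xs.length * (M + S * (2 * n + 2) + 33) +
      (32 + (0 + ((M + S * (2 * n + 2)) + (1 + 0)))))
    · apply Costs.bind (ih (j + 1))
      rintro rows ⟨hlen, hrows⟩
      apply Costs.bind (Costs.hasLoop x)
      intro b _
      apply Costs.ite
      · intro _
        exact Costs.pure ⟨hlen.trans (by simp), hrows⟩
      · intro _
        apply Costs.bind ((Costs.mapT_sum fun e he =>
          Costs.evalCoeff k j (hg.2.2 e he).2).le _)
        · intro row hrow
          apply Costs.bind Costs.tick
          intro _ _
          refine Costs.pure ⟨by simpa using hlen, ?_⟩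
          rw [List.forall_mem_cons]
          exact ⟨hrow.length_eq.symm, hrows⟩
        · rw [List.sum_map_mul_right]
          exact add_le_add hg.1 (Nat.mul_le_mul_right _ hg.2.1)
    · rw [List.length_cons, add_mul, one_mul]
      omega

/-! ### Gauss-Jordan elimination -/

section Elimination

variable {K : Type} [Field K]

theorem Costs.isZeroT (x : K) : Costs (isZeroT x) 1 fun b => b = true ↔ x = 0 := by
  apply Costs.bind (T₂ := 0) Costs.tick
  intro _ _
  exact Costs.pure (by simp)

theorem Costs.subRow (x : K) {r s : List K} (h : r.length = s.length) :
    Costs (subRow x r s) (2 * r.length) fun r' =>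
      r'.length = r.length ∧ ∀ j, entry r' j = entry r j - x * entry s j := by
  induction r generalizing s with
  | nil =>
    obtain rfl : s = [] := List.length_eq_zero_iff.mp h.symm
    exact Costs.pure (by simp [entry])
  | cons a r ih =>
    obtain ⟨b, s, rfl⟩ := List.exists_cons_of_length_eq_add_one h.symm
    rw [RiemCanon.subRow]
    apply Costs.le (T := 2 + (2 * r.length + 0))
    · apply Costs.bind Costs.tick
      intro _ _
      apply Costs.bind (ih (by simpa using h))
      rintro t ⟨h1, h2⟩
      refine Costs.pure ⟨by simp [h1], ?_⟩
      rintro (_ | j)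
      · simp [entry]
      · simpa [entry] using h2 j
    · rw [List.length_cons]
      omega

theorem Costs.clearRow (c : ℕ) {piv r : List K} (h : r.length = piv.length) :
    Costs (clearRow c piv r) (1 + 2 * r.length) fun r' =>
      r'.length = r.length ∧ ∀ j, entry r' j = entry r j - entry r c * entry piv j := by
  apply Costs.bind (Costs.isZeroT _)
  intro b hb
  split_ifs with h0
  · rw [hb] at h0
    exact (Costs.pure (by simp [h0])).le (Nat.zero_le _)
  · exact Costs.subRow _ h

/-- The state `S` of the elimination when the columns before `c` of the matrix `H` with `b` columns
have been treated. A pivot column has entries `0` and `1` only, and is not a zero column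
of `H`; a zero column of `H` remains one. -/
structure Eliminated (H : List (List K)) (b c : ℕ) (S : List (List K) × List (List K)) : Prop where
  length : S.1.length + S.2.length ≤ H.length
  width : ∀ r ∈ S.1 ++ S.2, r.length = b
  todo : ∀ r ∈ S.2, ∀ j < c, entry r j = 0
  zero : ∀ j, (∀ r ∈ H, entry r j = 0) → ∀ r ∈ S.1 ++ S.2, entry r j = 0
  pivots : ∃ P : Finset ℕ, P.card = S.1.length ∧ ∀ j ∈ P, j < c ∧ (∃ r ∈ H, entry r j ≠ 0) ∧
    ∀ r ∈ S.1, entry r j = 0 ∨ entry r j = 1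
  first : 0 < c → ∀ r ∈ S.1, entry r 0 = 0 ∨ entry r 0 = 1

/-- The cost of a step with a pivot, for a matrix with `N` rows and `b` columns. -/
def pivotCost (N b : ℕ) : ℕ := 8 * (N + 1) * (b + 1)

open Classical in
theorem Costs.isNonzero (x : K) : Costs (do
      let z ← RiemCanon.isZeroT x
      Pure.pure (!z)) 1 fun b => b = decide (x ≠ 0) :=
  Costs.bind (T₂ := 0) (Costs.isZeroT x) fun z hz => Costs.pure (by cases z <;> simp_all)

theorem entry_map {L : Type} [Field L] {g : K → L} (hg : g 0 = 0) (r : List K) (j : ℕ) :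
    entry (r.map g) j = g (entry r j) := by
  rw [entry, entry, ← List.getD_map (f := g), hg]

/-- If the rows without a pivot are zero in column `c`, this column needs no treatment. -/
theorem Eliminated.of_no_pivot {H : List (List K)} {b c : ℕ}
    {S : List (List K) × List (List K)} (hS : Eliminated H b c S)
    (hc : ∀ r ∈ S.2, entry r c = 0) : Eliminated H b (c + 1) S := by
  obtain ⟨P, hP, hPj⟩ := hS.pivots
  refine ⟨hS.length, hS.width, fun r hr j hj => ?_, hS.zero,
    ⟨P, hP, fun j hj => ⟨(hPj j hj).1.trans (Nat.lt_succ_self c), (hPj j hj).2⟩⟩, fun _ => ?_⟩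
  · rcases Nat.lt_succ_iff_lt_or_eq.mp hj with h | rfl
    · exact hS.todo r hr j h
    · exact hc r hr
  · rcases Nat.eq_zero_or_pos c with rfl | h
    · have hP0 : P = ∅ := Finset.eq_empty_of_forall_notMem fun j hj =>
        Nat.not_lt_zero j (hPj j hj).1
      rw [hP0, Finset.card_empty] at hP
      rw [List.length_eq_zero_iff.mp hP.symm]
      simp
    · exact hS.first h

/-- The effect of a pivot row `piv`, obtained from the row `r`, on the rows treated before and on
the other rows. -/
theorem Eliminated.of_pivot {H : List (List K)} {b c : ℕ} {done todo done' todo' : List (List K)}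
    {r piv : List K} (hS : Eliminated H b c (done, todo)) (hr : r ∈ todo) (hrc : entry r c ≠ 0)
    (hpiv : piv.length = r.length ∧ ∀ j, entry piv j = entry r j / entry r c)
    (hdone : done'.length = done.length) (htodo : todo'.length + 1 = todo.length)
    (hdone' : ∀ y ∈ done', ∃ x ∈ done, y.length = x.length ∧
      ∀ j, entry y j = entry x j - entry x c * entry piv j)
    (htodo' : ∀ y ∈ todo', ∃ x ∈ todo, y.length = x.length ∧
      ∀ j, entry y j = entry x j - entry x c * entry piv j) :
    Eliminated H b (c + 1) (done' ++ [piv], todo') := by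
  have hr' : r ∈ done ++ todo := List.mem_append_right _ hr
  have hone : entry piv c = 1 := by rw [hpiv.2, div_self hrc]
  have hbefore : ∀ j < c, entry piv j = 0 := fun j hj => by
    rw [hpiv.2, hS.todo r hr j hj, zero_div]
  have hall : ∀ y ∈ (done' ++ [piv]) ++ todo', y = piv ∨ ∃ x ∈ done ++ todo,
      y.length = x.length ∧ ∀ j, entry y j = entry x j - entry x c * entry piv j := by
    intro y hy
    rw [List.mem_append, List.mem_append, List.mem_singleton] at hy
    rcases hy with (hy | rfl) | hy
    · obtain ⟨x, hx, h⟩ := hdone' y hy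
      exact .inr ⟨x, List.mem_append_left _ hx, h⟩
    · exact .inl rfl
    · obtain ⟨x, hx, h⟩ := htodo' y hy
      exact .inr ⟨x, List.mem_append_right _ hx, h⟩
  refine ⟨?_, fun y hy => ?_, fun y hy j hj => ?_, fun j hj y hy => ?_, ?_, fun _ y hy => ?_⟩
  · have := hS.length
    simp only [List.length_append, List.length_singleton] at this ⊢
    omega
  · rcases hall y hy with rfl | ⟨x, hx, h, -⟩
    · rw [hpiv.1]
      exact hS.width r hr'
    · rw [h]
      exact hS.width x hx
  · obtain ⟨x, hx, -, h⟩ := htodo' y hy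
    rw [h]
    rcases Nat.lt_succ_iff_lt_or_eq.mp hj with hj | rfl
    · rw [hbefore j hj, hS.todo x hx j hj, mul_zero, sub_zero]
    · rw [hone, mul_one, sub_self]
  · have hpj : entry piv j = 0 := by rw [hpiv.2, hS.zero j hj r hr', zero_div]
    rcases hall y hy with rfl | ⟨x, hx, -, h⟩
    · exact hpj
    · rw [h, hpj, hS.zero j hj x hx, mul_zero, sub_zero]
  · obtain ⟨P, hP, hPj⟩ := hS.pivots
    refine ⟨insert c P, ?_, fun j hj => ?_⟩
    · rw [Finset.card_insert_of_notMem fun h => lt_irrefl c (hPj c h).1, hP, List.length_append,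
        List.length_singleton, hdone]
    · rcases Finset.mem_insert.mp hj with rfl | hj
      · refine ⟨Nat.lt_succ_self _, ?_, fun y hy => ?_⟩
        · by_contra! h
          exact hrc (hS.zero j h r hr')
        · rcases List.mem_append.mp hy with hy | hy
          · obtain ⟨x, hx, -, h⟩ := hdone' y hy
            rw [h, hone, mul_one, sub_self]
            exact .inl rfl
          · rw [List.mem_singleton.mp hy]
            exact .inr hone
      · obtain ⟨h1, h2, h3⟩ := hPj j hj
        refine ⟨h1.trans (Nat.lt_succ_self c), h2, fun y hy => ?_⟩
        rcases List.mem_append.mp hy with hy | hy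
        · obtain ⟨x, hx, -, h⟩ := hdone' y hy
          rw [h, hbefore j h1, mul_zero, sub_zero]
          exact h3 x hx
        · rw [List.mem_singleton.mp hy]
          exact .inl (hbefore j h1)
  · rcases List.mem_append.mp hy with hy | hy
    · obtain ⟨x, hx, -, h⟩ := hdone' y hy
      rw [h]
      rcases Nat.eq_zero_or_pos c with rfl | hc
      · rw [hone, mul_one, sub_self]
        exact .inl rfl
      · rw [hbefore 0 hc, mul_zero, sub_zero]
        exact hS.first hc x hx
    · rw [List.mem_singleton.mp hy]
      rcases Nat.eq_zero_or_pos c with rfl | hc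
      · exact .inr hone
      · exact .inl (hbefore 0 hc)

theorem Runs.rrefStep {H : List (List K)} {b c : ℕ} {S : List (List K) × List (List K)}
    (hS : Eliminated H b c S) :
    Runs (rrefStep S c) fun S' k => Eliminated H b (c + 1) S' ∧
      k + S.1.length * pivotCost H.length b ≤
        2 * H.length + S'.1.length * pivotCost H.length b := by
  obtain ⟨done, todo⟩ := S
  have hlen := hS.length
  have hwidth : ∀ r ∈ done ++ todo, r.length = b := hS.width
  simp only at hlen
  rw [RiemCanon.rrefStep]
  refine Runs.bind (Costs.findT fun r _ => Costs.isNonzero (entry r c)) ?_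
  rintro (_ | ⟨i, r⟩) k ⟨hk, hr⟩
  · refine Runs.pure ⟨hS.of_no_pivot fun r hr' => by simpa using hr r hr', ?_⟩
    simp only at hk ⊢
    omega
  · obtain ⟨hr, hrc, -, hi⟩ := hr
    replace hrc : entry r c ≠ 0 := by simpa using hrc
    simp only at hi hk
    have hrb : r.length = b := hwidth r (List.mem_append_right _ hr)
    have hmul : ∀ m ≤ H.length, m * (1 + 2 * b + 1) ≤ H.length * (1 + 2 * b + 1) :=
      fun m hm => Nat.mul_le_mul_right _ hm
    refine Runs.mono (P := fun S' k' => k' ≤ pivotCost H.length b ∧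
      (Eliminated H b (c + 1) S' ∧ S'.1.length = done.length + 1)) ?_ ?_
    · change Costs _ _ _
      apply Costs.le (T := b * 2 + (H.length + (H.length * (1 + 2 * b + 1) +
        (H.length * (1 + 2 * b + 1) + (H.length + 0)))))
      · apply Costs.bind ((Costs.mapT_eq (T := 1) (g := fun x => x / entry r c) fun x _ =>
          Costs.bind (T₂ := 0) Costs.tick fun _ _ => Costs.pure rfl).le (by rw [hrb]))
        rintro _ rfl
        set piv := r.map fun x => x / entry r c with hpiv
        have hpivb : piv.length = b := by rw [hpiv, List.length_map, hrb]
        have hclear : ∀ x ∈ done ++ todo, Costs (RiemCanon.clearRow c piv x) (1 + 2 * b)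
            fun y => y.length = x.length ∧
              ∀ j, entry y j = entry x j - entry x c * entry piv j := fun x hx => by
          have h := Costs.clearRow c (piv := piv) (r := x) (by rw [hwidth x hx, hpivb])
          rwa [hwidth x hx] at h ⊢
        apply Costs.bind (Costs.tick.le (by simp only; omega))
        intro _ _
        apply Costs.bind ((Costs.mapT fun x hx => hclear x (List.mem_append_left _ hx)).le
          (hmul _ (by omega)))
        intro done' hdone'
        apply Costs.bind ((Costs.mapT fun x hx => hclear x (List.mem_append_right _
          (List.mem_of_mem_eraseIdx hx))).le
          (hmul _ ((List.length_eraseIdx_le _ _).trans (by omega))))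
        intro todo' htodo'
        have hlen' := hdone'.length_eq
        apply Costs.bind (Costs.appendT.le (by omega))
        rintro _ rfl
        refine Costs.pure ⟨hS.of_pivot hr hrc ⟨by rw [hpivb, hrb], fun j =>
          entry_map (zero_div _) r j⟩ hlen'.symm ?_ (fun y => exists_mem_left_of_forall₂ hdone')
          fun y hy => ?_, by simp [hlen']⟩
        · rw [← htodo'.length_eq, List.length_eraseIdx_of_lt (by omega)]
          omega
        · obtain ⟨x, hx, h⟩ := exists_mem_left_of_forall₂ htodo' hy
          exact ⟨x, List.mem_of_mem_eraseIdx hx, h⟩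
      · rw [pivotCost]
        nlinarith
    · rintro S' k' ⟨hk', hS', hlen'⟩
      refine ⟨hS', ?_⟩
      rw [hlen', add_mul, one_mul]
      simp only
      omega

/-- The cost of the reduction is proportional to its number of pivots. -/
theorem Runs.rref {H : List (List K)} {b : ℕ} (hH : ∀ r ∈ H, r.length = b) :
    Runs (rref b H) fun Q k => (∃ S, Eliminated H b b (Q, S)) ∧
      k ≤ b * (2 * H.length + 1) + Q.length * pivotCost H.length b := by
  rw [RiemCanon.rref]
  refine Runs.bind (Runs.foldT (I := fun rem S k => ∃ c, rem = List.range' c (b - c) ∧ c ≤ b ∧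
    Eliminated H b c S ∧ k ≤ c * (2 * H.length + 1) + S.1.length * pivotCost H.length b)
    ?_ (k := 0) ?_) ?_
  · rintro x xs S k ⟨c, hrem, hcb, hS, hk⟩
    have hlt : c < b := by
      by_contra h
      rw [Nat.sub_eq_zero_of_le (by omega)] at hrem
      cases hrem
    rw [show b - c = (b - (c + 1)) + 1 by omega, List.range'_succ] at hrem
    obtain ⟨rfl, rfl⟩ := List.cons.inj hrem
    refine (Runs.rrefStep hS).mono fun S' k' h => ⟨x + 1, rfl, hlt, h.1, ?_⟩
    have := h.2
    rw [add_mul x 1, one_mul]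
    omega
  · exact ⟨0, by rw [List.range_eq_range', Nat.sub_zero], Nat.zero_le _, ⟨by simp,
      by simpa using hH, by simp, by simp, ⟨∅, by simp, by simp⟩, by simp⟩, by simp⟩
  · rintro S k ⟨c, hrem, hcb, hS, hk⟩
    obtain rfl : c = b := by
      have := congrArg List.length hrem
      rw [List.length_nil, List.length_range'] at this
      omega
    refine Runs.pure ⟨⟨S.2, hS⟩, ?_⟩
    simpa using hk

end Elimination

/-! ### The iterated elimination -/

theorem rationalTerm_zero (k : ℕ) : rationalTerm k 0 = 0 := by
  induction k with
  | zero => rfl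
  | succ k ih =>
    change rationalTerm k ((RatFunc.num (0 : RatFunc (ParamField k)) /ₘ
      RatFunc.denom (0 : RatFunc (ParamField k))).coeff 0) = 0
    rw [RatFunc.num_zero, Polynomial.zero_divByMonic, Polynomial.coeff_zero, ih]

theorem rationalTerm_one (k : ℕ) : rationalTerm k 1 = 1 := by
  induction k with
  | zero => rfl
  | succ k ih =>
    change rationalTerm k ((RatFunc.num (1 : RatFunc (ParamField k)) /ₘ
      RatFunc.denom (1 : RatFunc (ParamField k))).coeff 0) = 1
    rw [RatFunc.num_one, RatFunc.denom_one, Polynomial.divByMonic_one, Polynomial.coeff_one_zero,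
      ih]

/-- A rational function minus its term in `ℚ`. -/
noncomputable def irrationalPart (k : ℕ) (x : ParamField k) : ParamField k :=
  x - (rationalTerm k x : ParamField k)

theorem irrationalPart_zero (k : ℕ) : irrationalPart k 0 = 0 := by
  rw [irrationalPart, rationalTerm_zero, Rat.cast_zero, sub_zero]

theorem irrationalPart_one (k : ℕ) : irrationalPart k 1 = 0 := by
  rw [irrationalPart, rationalTerm_one, Rat.cast_one, sub_self]

theorem entry_drop {K : Type} [Field K] (r : List K) (c j : ℕ) :
    entry (r.drop c) j = entry r (c + j) := by
  simp [entry, List.getD_eq_getElem?_getD]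

theorem isRational_of_zero_or_one {k : ℕ} {x : ParamField k} (h : x = 0 ∨ x = 1) :
    IsRational x := by
  rcases h with rfl | rfl
  · exact ⟨0, by simp⟩
  · exact ⟨1, by simp⟩

theorem Costs.rationalColumns {k : ℕ} (Q : List (List (ParamField k))) (c d : ℕ) :
    Costs (rationalColumns Q c d) (d * (2 * Q.length + 1)) fun r =>
      r ≤ d ∧ (0 < d → (∀ row ∈ Q, IsRational (entry row c)) → 0 < r) := by
  classical
  induction d generalizing c with
  | zero => exact (Costs.pure (by simp)).le (Nat.zero_le _)
  | succ d ih =>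
    rw [RiemCanon.rationalColumns]
    apply Costs.le (T := 1 + (Q.length * 2 + (0 + (d * (2 * Q.length + 1) + 0))))
    · apply Costs.bind Costs.tick
      intro _ _
      apply Costs.bind (Costs.anyT (T := 1) (q := fun row => decide (¬IsRational (entry row c)))
        fun row _ => Costs.bind (T₂ := 0) Costs.tick fun _ _ => Costs.pure (by congr))
      rintro b rfl
      apply Costs.ite
      · intro hb
        refine Costs.pure ⟨Nat.zero_le _, fun _ hall => ?_⟩
        obtain ⟨row, hrow, h⟩ := List.any_eq_true.mp hb
        exact absurd (hall row hrow) (of_decide_eq_true h)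
      · intro _
        apply Costs.bind (ih (c + 1))
        intro r hr
        exact Costs.pure ⟨Nat.succ_le_succ hr.1, fun _ _ => Nat.succ_pos r⟩
    · rw [add_mul, one_mul]
      omega

/-- The columns of a matrix with `b` columns that are not zero. -/
noncomputable def supportColumns {K : Type} [Field K] (H : List (List K)) (b : ℕ) : Finset ℕ := by
  classical exact (Finset.range b).filter fun j => ∃ r ∈ H, entry r j ≠ 0

theorem mem_supportColumns {K : Type} [Field K] {H : List (List K)} {b j : ℕ} :
    j ∈ supportColumns H b ↔ j < b ∧ ∃ r ∈ H, entry r j ≠ 0 := by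
  simp [supportColumns]

theorem card_supportColumns_le {K : Type} [Field K] (H : List (List K)) (b : ℕ) :
    (supportColumns H b).card ≤ b := by
  classical
  exact (Finset.card_filter_le _ _).trans (Finset.card_range b).le

/-- The pivot columns are zero in the next matrix if they are still present in it, so that each
pivot lowers the number of nonzero columns. -/
theorem card_supportColumns_next {k : ℕ} {H Q S H' : List (List (ParamField k))} {b c : ℕ}
    (hQ : Eliminated H b b (Q, S)) (hc : c ≤ b)
    (hH' : H' = Q.map fun r => (r.drop c).map (irrationalPart k)) :
    (supportColumns H' (b - c)).card + Q.length ≤ (supportColumns H b).card := by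
  classical
  obtain ⟨P, hP, hPj⟩ := hQ.pivots
  have hentry : ∀ r ∈ H', ∃ x ∈ Q, ∀ j, entry r j = irrationalPart k (entry x (c + j)) := by
    intro r hr
    rw [hH'] at hr
    obtain ⟨x, hx, rfl⟩ := List.mem_map.mp hr
    exact ⟨x, hx, fun j => by rw [entry_map (irrationalPart_zero k), entry_drop]⟩
  have hdisj : Disjoint ((supportColumns H' (b - c)).map (addLeftEmbedding c)) P := by
    rw [Finset.disjoint_left]
    intro j hj hjP
    obtain ⟨i, hi, rfl⟩ := Finset.mem_map.mp hj
    obtain ⟨-, r, hr, hne⟩ := mem_supportColumns.mp hi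
    obtain ⟨x, hx, hrx⟩ := hentry r hr
    rw [hrx] at hne
    rcases (hPj _ hjP).2.2 x hx with h | h
    · exact hne (by rw [← irrationalPart_zero k, ← h]; rfl)
    · exact hne (by rw [← irrationalPart_one k, ← h]; rfl)
  have hsub : ((supportColumns H' (b - c)).map (addLeftEmbedding c)) ∪ P ⊆
      supportColumns H b := by
    intro j hj
    rcases Finset.mem_union.mp hj with hj | hj
    · obtain ⟨i, hi, rfl⟩ := Finset.mem_map.mp hj
      obtain ⟨hib, r, hr, hne⟩ := mem_supportColumns.mp hi
      obtain ⟨x, hx, hrx⟩ := hentry r hr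
      refine mem_supportColumns.mpr ⟨?_, ?_⟩
      · change c + i < b
        omega
      · by_contra! h
        refine hne ?_
        rw [hrx, hQ.zero (c + i) h x (List.mem_append_left _ hx), irrationalPart_zero]
    · exact mem_supportColumns.mpr ⟨(hPj j hj).1, (hPj j hj).2.1⟩
  have := Finset.card_le_card hsub
  rw [Finset.card_union_of_disjoint hdisj, Finset.card_map, hP] at this
  exact this

/-- The invariant of the iterated elimination for `m` unknowns and at most `n` relations: the rows
obtained so far are no more than the columns that have been used up. -/
structure RebeState.Ok {k : ℕ} (n m : ℕ) (s : RebeState k) : Prop where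
  rows : s.H.length ≤ n
  width : ∀ r ∈ s.H, r.length = s.cols
  cols : s.q + s.cols = m
  outWidth : ∀ r ∈ s.C, r.length = m
  outLength : s.C.length + (supportColumns s.H s.cols).card ≤ m

/-- The rows of a complete row echelon form for `m` unknowns. -/
def RulesOk (m : ℕ) (C : List (List ℚ)) : Prop :=
  C.length ≤ m ∧ ∀ r ∈ C, r.length = m

/-- A round uses up at least one column and one nonzero column for each pivot, and its cost is
proportional to one plus the number of pivots. -/
theorem Runs.rebeStep {k n m : ℕ} {s : RebeState k} (hs : s.Ok n m) :
    Runs (rebeStep s) fun r c =>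
      match r with
      | .inl s' => s'.Ok n m ∧ ∃ d, 1 ≤ d ∧
          (s'.cols + (supportColumns s'.H s'.cols).card) + d ≤
            s.cols + (supportColumns s.H s.cols).card ∧ c ≤ 40 * (n + 1) * (m + 1) * d
      | .inr C => RulesOk m C ∧
          c ≤ 40 * (n + 1) * (m + 1) * (s.cols + (supportColumns s.H s.cols).card + 1) := by
  have hcols := hs.cols
  have hrows := hs.rows
  rw [RiemCanon.rebeStep]
  refine Runs.bind (P := fun _ c => c = 1) (Runs.tick rfl) ?_
  rintro _ _ rfl
  refine Runs.bind (Runs.rref hs.width) ?_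
  rintro Q k₁ ⟨⟨S, hQ⟩, hk₁⟩
  have hQlen : Q.length ≤ n := by
    have := hQ.length
    simp only at this
    omega
  have hQwidth : ∀ r ∈ Q, r.length = s.cols := fun r hr =>
    hQ.width r (List.mem_append_left _ hr)
  have hQsupp : Q.length ≤ (supportColumns s.H s.cols).card :=
    (Nat.le_add_left _ _).trans (card_supportColumns_next hQ le_rfl rfl)
  have hcost : 1 + k₁ + (s.cols * (2 * n + 1) + (Q.length * (2 * m + 1) + (Q.length * (m + 1) +
      (m + Q.length * (4 * m + 1))))) ≤ 40 * (n + 1) * (m + 1) * (Q.length + 1) := by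
    have h1 : s.cols * (2 * s.H.length + 1) ≤ m * (2 * n + 1) := by gcongr; omega
    have h2 : s.cols * (2 * n + 1) ≤ m * (2 * n + 1) := by gcongr; omega
    have h3 : Q.length * pivotCost s.H.length s.cols ≤ Q.length * (8 * (n + 1) * (m + 1)) := by
      rw [pivotCost]
      gcongr
      omega
    have h4 : 1 + (m * (2 * n + 1) + Q.length * (8 * (n + 1) * (m + 1))) + (m * (2 * n + 1) +
        (Q.length * (2 * m + 1) + (Q.length * (m + 1) + (m + Q.length * (4 * m + 1))))) ≤
        40 * (n + 1) * (m + 1) * (Q.length + 1) := by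
      ring_nf
      nlinarith [Nat.zero_le (n * m * Q.length)]
    omega
  -- what remains of the round, with the cost of the reduction accounted for
  suffices hrest : Costs _ (s.cols * (2 * n + 1) + (Q.length * (2 * m + 1) + (Q.length * (m + 1) +
      (m + Q.length * (4 * m + 1))))) (fun r : RebeState k ⊕ List (List ℚ) =>
      match r with
      | .inl s' => s'.Ok n m ∧ s'.cols < s.cols ∧
          (supportColumns s'.H s'.cols).card + Q.length ≤ (supportColumns s.H s.cols).card
      | .inr C => RulesOk m C) by
    refine Runs.mono hrest ?_
    rintro (s' | C) k₂ ⟨hk₂, h⟩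
    · exact ⟨h.1, Q.length + 1, by omega, by omega, by omega⟩
    · refine ⟨h, le_trans (b := 40 * (n + 1) * (m + 1) * (Q.length + 1)) (by omega) ?_⟩
      gcongr
      omega
  apply Costs.bind ((Costs.rationalColumns Q 0 s.cols).le (by gcongr))
  rintro c ⟨hc, hcpos⟩
  apply Costs.bind ((Costs.mapT (T := 2 * m) (R := fun _ (w : List ℚ) => w.length = s.cols)
    fun r hr => ((Costs.mapT_eq (T := 1) (g := rationalTerm k) fun x _ =>
      Costs.bind (T₂ := 0) Costs.tick fun _ _ => Costs.pure rfl).mono ?_ fun w hw => ?_)))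
  rotate_left
  · rw [hQwidth r hr]
    omega
  · rw [hw, List.length_map, hQwidth r hr]
  intro W hW
  have hWlen := hW.length_eq
  apply Costs.bind ((Costs.mapT (T := m) (R := fun _ (w : List ℚ) => w.length = m)
    fun w hw => (Costs.appendT.mono ?_ fun w' hw' => ?_)).le (by rw [hWlen]))
  rotate_left
  · rw [List.length_replicate]
    omega
  · obtain ⟨_, -, h⟩ := exists_mem_left_of_forall₂ hW hw
    rw [hw', List.length_append, List.length_replicate, h, hcols]
  intro W' hW'
  have hWlen' := hW'.length_eq
  have hout := hs.outLength
  apply Costs.bind (Costs.appendT.le (by omega))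
  rintro _ rfl
  have hwidth : ∀ r ∈ s.C ++ W', r.length = m := by
    intro r hr
    rcases List.mem_append.mp hr with hr | hr
    · exact hs.outWidth r hr
    · obtain ⟨_, -, h⟩ := exists_mem_left_of_forall₂ hW' hr
      exact h
  split_ifs with hlt
  · apply Costs.bind (T₂ := 0) ((Costs.mapT_eq (T := 4 * m)
      (g := fun r => (r.drop c).map (irrationalPart k)) fun r hr => ?_))
    · rintro _ rfl
      have hsupp := card_supportColumns_next hQ hc rfl
      have hfirst : 0 < c := hcpos (by omega) fun row hrow =>
        isRational_of_zero_or_one (hQ.first (by omega) row hrow)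
      refine Costs.pure ⟨⟨by simpa using hQlen, ?_, ?_, hwidth, ?_⟩, ?_, hsupp⟩
      · intro r hr
        obtain ⟨x, hx, rfl⟩ := List.mem_map.mp hr
        simp [hQwidth x hx]
      · simp only
        omega
      · simp only [List.length_append]
        omega
      · simp only
        omega
    · apply Costs.le (T := m + m * 3)
      · apply Costs.bind (Costs.tick.le (by omega))
        intro _ _
        refine (Costs.mapT_eq (T := 2) (g := irrationalPart k) fun x _ =>
          Costs.bind (T₂ := 0) Costs.tick fun _ _ => Costs.pure rfl).le ?_
        rw [List.length_drop, hQwidth r hr]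
        omega
      · omega
  · refine (Costs.pure ⟨?_, hwidth⟩).le (Nat.zero_le _)
    rw [List.length_append]
    omega

/-- The unknowns and the rules returned by `rebe`. -/
def RebeOk (n M : ℕ) (r : List (List Factor) × List (List ℚ)) : Prop :=
  r.1.length ≤ M ∧ (∀ x ∈ r.1, x.length ≤ n) ∧ RulesOk r.1.length r.2

/-- Each pivot costs `O(n m)` operations, and so does each round apart from its pivots; there are
at most `m` pivots and `m + 1` rounds, for `m ≤ 3 ^ n` unknowns. -/
theorem Costs.rebe {n : ℕ} {f : List Factor} (hlen : f.length ≤ n)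
    (hpaired : Paired (word f)) (hint : NoInt (word f)) :
    Costs (rebe f) (950000 * ((n + 1) * (3 ^ n * 3 ^ n))) (RebeOk n (3 ^ n)) := by
  have hpos : 1 ≤ 3 ^ n := Nat.one_le_pow _ _ (by norm_num)
  have hnM : n + 1 ≤ 3 ^ n := Nat.lt_pow_self (by norm_num)
  rw [RiemCanon.rebe]
  set M := 3 ^ n with hM
  apply Costs.le (T := 940000 * ((n + 1) * (M * M)) + (n * (M + M * (2 * n + 2) + 33) +
    (40 * (n + 1) * (M + 1) * (2 * M + 1) + (M + 0))))
  · apply Costs.bind (Costs.pnomExtension hlen hpaired hint)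
    intro g hg
    have hgM : g.length ≤ M := hg.1
    apply Costs.bind ((Costs.bianchiRows _ hg 0 f).le (Nat.mul_le_mul_right _ hlen))
    rintro H ⟨hHlen, hHwidth⟩
    have hstate : RebeState.Ok n g.length
        (⟨H, g.length, 0, []⟩ : RebeState (3 * f.length)) :=
      ⟨hHlen.trans hlen, hHwidth, Nat.zero_add _, by simp,
        by simpa using card_supportColumns_le H g.length⟩
    apply Costs.bind ((Costs.loop (I := RebeState.Ok n g.length)
      (μ := fun s => s.cols + (supportColumns s.H s.cols).card)
      (A := 40 * (n + 1) * (g.length + 1)) (Q := RulesOk g.length) (fun s hs =>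
        (Runs.rebeStep hs).mono (by rintro (s' | C) c h <;> exact h)) hstate).le ?_)
    · intro C hC
      apply Costs.bind (T₂ := 0) ((Costs.mapT_eq (T := 0) (g := Entry.mono) fun e _ =>
        Costs.pure rfl).le (by omega))
      rintro _ rfl
      refine Costs.pure ⟨by simpa using hgM, fun x hx => ?_, by simpa using hC⟩
      obtain ⟨e, he, rfl⟩ := List.mem_map.mp hx
      exact (hg.2.2 e he).1
    · have := card_supportColumns_le H g.length
      simp only
      gcongr
      omega
  · have h1 : n * (M + M * (2 * n + 2) + 33) ≤ (n + 1) * (36 * (M * M)) := by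
      have : M + M * (2 * n + 2) + 33 ≤ 36 * (M * M) := by nlinarith
      exact Nat.mul_le_mul (Nat.le_succ n) this
    have h2 : 40 * (n + 1) * (M + 1) * (2 * M + 1) ≤ (n + 1) * (240 * (M * M)) := by
      have : (M + 1) * (2 * M + 1) ≤ (2 * M) * (3 * M) := Nat.mul_le_mul (by omega) (by omega)
      calc 40 * (n + 1) * (M + 1) * (2 * M + 1) = 40 * (n + 1) * ((M + 1) * (2 * M + 1)) := by ring
        _ ≤ 40 * (n + 1) * ((2 * M) * (3 * M)) := by gcongr
        _ = (n + 1) * (240 * (M * M)) := by ring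
    have h3 : M ≤ (n + 1) * (M * M) :=
      (Nat.le_mul_of_pos_right M hpos).trans (Nat.le_mul_of_pos_left _ (Nat.succ_pos n))
    nlinarith

/-! ### The normal form -/

theorem Costs.leading {m : ℕ} {row : List ℚ} (h : row.length = m) :
    Costs (leading row) (2 * m) fun r => r.2.length = m := by
  apply Costs.le (T := m * 2 + 0)
  · apply Costs.bind ((Costs.findT fun x _ => Costs.isNonzero x).le (by rw [h]))
    rintro (_ | ⟨i, x⟩) _ <;> exact Costs.pure h
  · omega

theorem Costs.eliminate {m : ℕ} {rules : List (ℕ × List ℚ)} (hlen : rules.length ≤ m)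
    (hrules : ∀ r ∈ rules, r.2.length = m) {v : List ℚ} (hv : v.length = m) (c : ℕ) :
    Costs (eliminate rules v c) (4 * m + 1) fun v' => v'.length = m := by
  apply Costs.le (T := 1 + (0 + (m * 2 + 2 * m)))
  · apply Costs.bind (Costs.isZeroT _)
    intro b _
    apply Costs.ite
    · exact fun _ => Costs.pure hv
    intro _
    apply Costs.bind ((Costs.findT (T := 1) (q := fun r : ℕ × List ℚ => decide (r.1 = c)) fun r _ =>
      Costs.bind (T₂ := 0) Costs.tick fun _ _ => Costs.pure rfl).le (by gcongr))
    rintro (_ | ⟨i, r⟩) hr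
    · exact (Costs.pure (P := fun v' : List ℚ => v'.length = m) hv).le (Nat.zero_le _)
    · exact (Costs.subRow _ (hv.trans (hrules r hr.1).symm)).mono (by rw [hv])
        fun v' hv' => hv'.1.trans hv
  · omega

theorem Costs.applyRules {m : ℕ} {C : List (List ℚ)} (hC : RulesOk m C) (j : ℕ) :
    Costs (applyRules C m j) (m * (6 * m + 5)) fun _ => True := by
  apply Costs.le (T := m * 2 + (m * (2 * m + 1) + m * (4 * m + 1 + 1)))
  · apply Costs.bind ((Costs.mapT_eq (T := 1) (g := fun i => if i = j then (1 : ℚ) else 0)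
      fun i _ => Costs.bind (T₂ := 0) Costs.tick fun _ _ => Costs.pure rfl).le
        (by rw [List.length_range]))
    rintro v rfl
    apply Costs.bind ((Costs.mapT fun row hrow => Costs.leading (hC.2 row hrow)).le
      (Nat.mul_le_mul_right _ hC.1))
    intro rules hrules
    refine ((Costs.foldT (I := fun _ (v : List ℚ) => v.length = m) (fun c _ v hv =>
      Costs.eliminate (hrules.length_eq ▸ hC.1) (fun r hr => ?_) hv c) ?_).le ?_).trivial
    · obtain ⟨_, -, h⟩ := exists_mem_left_of_forall₂ hrules hr
      exact h
    · rw [List.length_map, List.length_range]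
    · rw [List.length_range]
  · ring_nf
    omega

theorem Costs.combine (c : ℚ) (h : List (List Factor)) (v : List ℚ) :
    Costs (combine c h v) (2 * h.length) fun r =>
      r.length ≤ h.length ∧ ∀ p ∈ r, p.factors ∈ h := by
  induction h generalizing v with
  | nil => exact Costs.pure (by simp)
  | cons x h ih =>
    cases v with
    | nil => exact (Costs.pure (by simp)).le (Nat.zero_le _)
    | cons a v =>
      rw [RiemCanon.combine]
      apply Costs.le (T := 2 + (2 * h.length + 0))
      · apply Costs.bind Costs.tick
        intro _ _
        apply Costs.bind (ih v)
        rintro r ⟨hlen, hr⟩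
        rw [List.length_cons]
        split_ifs
        · exact Costs.pure ⟨by omega, fun p hp => List.mem_cons_of_mem _ (hr p hp)⟩
        · refine Costs.pure ⟨by simpa using hlen, ?_⟩
          rw [List.forall_mem_cons]
          exact ⟨List.mem_cons_self, fun p hp => List.mem_cons_of_mem _ (hr p hp)⟩
      · rw [List.length_cons]
        omega

theorem Costs.restoreSeat {B : ℕ} {U seen : List Idx} (hU : U.length ≤ B)
    (hseen : seen.length + 1 ≤ B) (i : Idx) :
    Costs (restoreSeat U seen i) (4 * B + 1) fun r => r.2.length ≤ seen.length + 1 := by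
  have hany : ∀ l : List Idx, l.length ≤ B → Costs (RiemCanon.anyT (RiemCanon.eqIdx i) l) (2 * B)
      fun _ => True := fun l hl =>
    (Costs.anyT fun y _ => Costs.eqIdx i y).mono (by omega) fun _ _ => True.intro
  apply Costs.le (T := 1 + ((2 * B + 0) + (2 * B + 0)))
  · apply Costs.bind (Costs.inspect _ _)
    intro b _
    apply Costs.ite
    · intro _
      apply Costs.bind (hany U hU)
      exact fun u _ => Costs.pure (Nat.le_succ _)
    · intro _
      apply Costs.bind (hany seen (by omega))
      exact fun u _ => Costs.pure le_rfl
  · omega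

theorem Costs.restoreFactors {B : ℕ} {U seen : List Idx} (hU : U.length ≤ B) {l : List Factor}
    (hseen : seen.length + 4 * l.length ≤ B) :
    Costs (restoreFactors U seen l) (l.length * (16 * B + 5)) fun _ => True := by
  induction l generalizing seen with
  | nil => exact (Costs.pure True.intro).le (Nat.zero_le _)
  | cons x xs ih =>
    rw [List.length_cons] at hseen
    rw [RiemCanon.restoreFactors]
    apply Costs.le (T := (4 * B + 1) + ((4 * B + 1) + ((4 * B + 1) + ((4 * B + 1) +
      (xs.length * (16 * B + 5) + (1 + 0))))))
    · apply Costs.bind (Costs.restoreSeat hU (by omega) _)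
      intro a ha
      apply Costs.bind (Costs.restoreSeat hU (by omega) _)
      intro b hb
      apply Costs.bind (Costs.restoreSeat hU (by omega) _)
      intro c hc
      apply Costs.bind (Costs.restoreSeat hU (by omega) _)
      intro d hd
      apply Costs.bind (ih (by omega))
      intro r _
      apply Costs.bind Costs.tick
      intro _ _
      exact Costs.pure True.intro
    · rw [List.length_cons, add_mul, one_mul]
      omega

theorem Costs.restore {n : ℕ} {U : List Idx} (hU : U.length ≤ 4 * n) {p : Mono}
    (hp : p.factors.length ≤ n) :
    Costs (restore U p) (n * (64 * n + 5)) fun _ => True := by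
  refine Costs.bind (T₂ := 0) ((Costs.restoreFactors (B := 4 * n) hU ?_).le ?_)
    fun l _ => Costs.pure True.intro
  · simp only [List.length_nil]
    omega
  · calc p.factors.length * (16 * (4 * n) + 5) ≤ n * (16 * (4 * n) + 5) :=
        Nat.mul_le_mul_right _ hp
      _ = n * (64 * n + 5) := by ring

theorem Costs.upperFree {n : ℕ} {l : List RFactor} (hl : l.length = n) :
    Costs (upperFree l) (13 * n) fun U => U.length ≤ 4 * n := by
  refine (Costs.foldT (T := 12) (I := fun rem U => U.length + 4 * rem.length ≤ 4 * n)
    (fun x xs U hU => ?_) (by simp [hl])).mono (by omega) fun U hU => by simpa using hU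
  rw [List.length_cons] at hU
  refine (Costs.foldT (l := x.seats) (T := 2)
    (I := fun rem U => U.length + rem.length + 4 * xs.length ≤ 4 * n)
    (fun s ss U hU => ?_) ?_).mono le_rfl fun U hU => by simpa using hU
  · rw [List.length_cons] at hU
    apply Costs.bind (T₁ := 1) (T₂ := 1 + 0 + 0) (Costs.inspect _ _)
    intro b _
    apply Costs.ite
    · intro _
      apply Costs.bind Costs.tick
      intro _ _
      split_ifs
      · refine Costs.pure ?_
        rw [List.length_cons]
        omega
      · exact Costs.pure (by omega)
    · exact fun _ => Costs.pure (by omega)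
  · change U.length + 4 + _ ≤ _
    omega

theorem Costs.stripFactor (x : RFactor) :
    Costs (stripFactor x) 4 fun y => y.idx = x.seats.map Seat.name :=
  Costs.bind (T₂ := 0) Costs.tick fun _ _ => Costs.pure rfl

theorem word_eq_of_forall₂ {l : List RFactor} {l' : List Factor}
    (h : List.Forall₂ (fun x y => y.idx = x.seats.map Seat.name) l l') :
    word l' = (l.flatMap RFactor.seats).map Seat.name := by
  induction h with
  | nil => rfl
  | @cons x y l l' hxy _ ih =>
    change y.idx ++ word l' = (x.seats ++ l.flatMap RFactor.seats).map Seat.name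
    rw [hxy, ih, List.map_append]

theorem RMonomial.IsProper.noInt {f : RMonomial} (hf : f.IsProper) :
    NoInt (f.seats.map Seat.name) := by
  rintro (k | k | k) hi
  · exact .inl rfl
  · exact absurd hi (List.count_eq_zero.mp (hf.2.1 k))
  · exact .inr rfl

/-- A dummy index has one seat in each row. -/
theorem RMonomial.IsProper.paired {f : RMonomial} (hf : f.IsProper) :
    Paired (f.seats.map Seat.name) := by
  rintro (k | k | k) hi hfree
  · cases hfree
  · exact absurd hi (List.count_eq_zero.mp (hf.2.1 k))
  · obtain ⟨⟨_, u⟩, hs, rfl⟩ := List.mem_map.mp hi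
    have hcount := (hf.2.2 k).1
    have hboth : ⟨.dum k, true⟩ ∈ f.seats ∧ ⟨.dum k, false⟩ ∈ f.seats := by
      rw [← List.count_pos_iff, ← List.count_pos_iff, ← hcount, and_self]
      cases u
      · rw [hcount]
        exact List.count_pos_iff.mpr hs
      · exact List.count_pos_iff.mpr hs
    obtain ⟨l, hl, hsub⟩ : List.Subperm [⟨.dum k, true⟩, ⟨.dum k, false⟩] f.seats :=
      List.subperm_of_subset (by simp) (by simpa using hboth)
    calc 2 = (([⟨.dum k, true⟩, ⟨.dum k, false⟩] : List Seat).map Seat.name).count (.dum k) := by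
          simp
      _ = (l.map Seat.name).count (.dum k) := (hl.map Seat.name).count_eq _ |>.symm
      _ ≤ _ := (hsub.map Seat.name).count_le _

/-- The index that replaces an index when the integers become dummy indices. -/
def freshName : Idx → Idx
  | .int k => .dum k
  | j => j

theorem Costs.freshFactor (x : Factor) :
    Costs (freshFactor x) 4 fun y => y.idx = x.idx.map freshName := by
  have h : ∀ i, Costs (freshIdx i) 1 fun j => j = freshName i := by
    intro i
    apply Costs.bind (T₂ := 0) Costs.tick
    intro _ _
    cases i <;> exact Costs.pure rfl
  apply Costs.bind (T₁ := 1) (T₂ := 3) (h _)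
  rintro _ rfl
  apply Costs.bind (T₁ := 1) (T₂ := 2) (h _)
  rintro _ rfl
  apply Costs.bind (T₁ := 1) (T₂ := 1) (h _)
  rintro _ rfl
  apply Costs.bind (T₁ := 1) (T₂ := 0) (h _)
  rintro _ rfl
  exact Costs.pure rfl

theorem noInt_map_freshName (w : List Idx) : NoInt (w.map freshName) := by
  intro i hi
  obtain ⟨j, -, rfl⟩ := List.mem_map.mp hi
  cases j <;> simp [freshName, Idx.isFree, Idx.isOpen]

theorem isFree_freshName (i : Idx) : (freshName i).isFree = i.isFree := by
  cases i <;> rfl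

/-- The rewriting of the pre-normal form by the rules of `rebe`, followed by a computation `next`
on the resulting terms. -/
theorem Costs.rewriteTerms {α : Type} {n T : ℕ} {p : Mono} (hp : p.Ok n) (c : ℚ)
    {next : List Mono → Alg α} {Q : α → Prop}
    (hnext : ∀ terms : List Mono, (terms.length ≤ 3 ^ n ∧ ∀ q ∈ terms, q.factors.length ≤ n) →
      Costs (next terms) T Q) :
    Costs (do
      let fresh ← RiemCanon.mapT RiemCanon.freshFactor p.factors
      let r ← RiemCanon.rebe fresh
      match ← RiemCanon.findT (fun h => do
          let o ← RiemCanon.cmpWord (word h) (word p.factors)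
          Pure.pure (o == .eq)) 0 r.1 with
      | none => do
        let terms ← Pure.pure [⟨c, p.factors⟩]
        next terms
      | some (j, _) => do
        let v ← RiemCanon.applyRules r.2 r.1.length j
        let terms ← RiemCanon.combine c r.1 v
        next terms) (960000 * ((n + 1) * (3 ^ n * 3 ^ n)) + T) Q := by
  have hpos : 1 ≤ 3 ^ n := Nat.one_le_pow _ _ (by norm_num)
  have hcmp : ∃ q : List Factor → Bool, ∀ h : List Factor, Costs (do
      let o ← RiemCanon.cmpWord (word h) (word p.factors)
      Pure.pure (o == Ordering.eq)) (4 * h.length) fun b => b = q h := by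
    choose q k h1 h2 using fun h : List Factor =>
      Costs.bind (T₂ := 0) (Q := fun _ => True) (f := fun o => Pure.pure (o == Ordering.eq))
        (Costs.cmpWord (word h) (word p.factors)) fun o _ => Costs.pure True.intro
    refine ⟨q, fun h => ⟨q h, k h, h1 h, (h2 h).1.trans (by rw [length_word]; omega), rfl⟩⟩
  obtain ⟨q, hq⟩ := hcmp
  set M := 3 ^ n with hM
  apply Costs.le (T := 5 * n + (950000 * ((n + 1) * (M * M)) + (M * (4 * n + 1) +
    (M * (6 * M + 5) + (2 * M + T)))))
  · apply Costs.bind ((Costs.mapT fun x _ => Costs.freshFactor x).le (by have := hp.1; omega))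
    intro fresh hfresh
    have hperm := word_perm_map (ρ := freshName) (hfresh.imp fun x y h => h ▸ .refl _)
    have hlen : fresh.length ≤ n := hfresh.length_eq ▸ hp.1
    apply Costs.bind (Costs.rebe hlen ((hp.2.map isFree_freshName).perm hperm.symm) fun i hi =>
      noInt_map_freshName _ i (hperm.mem_iff.mp hi))
    rintro ⟨h, C⟩ ⟨hhM, hhn, hC⟩
    simp only at hhM hhn hC ⊢
    apply Costs.bind ((Costs.findT fun x hx =>
      (hq x).le (Nat.mul_le_mul_left 4 (hhn x hx))).le (Nat.mul_le_mul_right _ hhM))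
    rintro (_ | ⟨j, x⟩) _
    · apply Costs.le (T := 0 + T)
      · refine Costs.bind (Costs.pure rfl) fun terms hterms => hnext terms ?_
        rw [← hterms]
        exact ⟨by simpa using hpos, by simpa using hp.1⟩
      · omega
    · apply Costs.bind ((Costs.applyRules hC j).le (by gcongr))
      intro v _
      apply Costs.bind ((Costs.combine c h v).le (by omega))
      intro r hr
      exact hnext r ⟨hr.1.trans hhM, fun t ht => hhn _ (hr.2 t ht)⟩
  · have h1 : n * M ≤ n * (M * M) := Nat.mul_le_mul_left _ (Nat.le_mul_of_pos_right M hpos)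
    have h2 : n ≤ n * M := Nat.le_mul_of_pos_right n hpos
    have h3 : M ≤ M * M := Nat.le_mul_of_pos_right M hpos
    nlinarith

theorem Costs.normal {n : ℕ} {f : RMonomial} (hn : f.degree = n) (hf : f.IsProper) :
    Costs (normal f) (2000000 * ((n + 1) * (3 ^ n * 3 ^ n))) fun _ => True := by
  have hpos : 1 ≤ 3 ^ n := Nat.one_le_pow _ _ (by norm_num)
  have hnM : n + 1 ≤ 3 ^ n := Nat.lt_pow_self (by norm_num)
  have hlen : f.factors.length = n := hn
  rw [RiemCanon.normal]
  set M := 3 ^ n with hM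
  have hrestore : ∀ (U : List Idx) (terms : List Mono), U.length ≤ 4 * n →
      (terms.length ≤ M ∧ ∀ q ∈ terms, q.factors.length ≤ n) →
      Costs (RiemCanon.mapT (RiemCanon.restore U) terms) (M * (n * (64 * n + 5) + 1))
        fun _ => True := fun U terms hU hterms =>
    (Costs.mapT fun q hq => Costs.restore hU (hterms.2 q hq)).mono
      (Nat.mul_le_mul_right _ hterms.1) fun _ _ => True.intro
  apply Costs.le (T := 13 * n + (5 * n + (930000 * M + (1 + (0 + (M * (n * (64 * n + 5) + 1) +
    (960000 * ((n + 1) * (M * M)) + M * (n * (64 * n + 5) + 1))))))))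
  · apply Costs.bind (Costs.upperFree hlen)
    intro U hU
    apply Costs.bind ((Costs.mapT fun x _ => Costs.stripFactor x).le (by omega))
    intro l hl
    have hword : word l = f.seats.map Seat.name := word_eq_of_forall₂ hl
    have hllen := hl.length_eq
    apply Costs.bind (Costs.pnom_le (n := n) (by omega) (hword ▸ hf.paired) (hword ▸ hf.noInt))
    intro p hp
    apply Costs.bind Costs.tick
    intro _ _
    apply Costs.ite
    · exact fun _ => Costs.pure True.intro
    intro _
    have hsingle : ∀ c, ([⟨c, p.factors⟩] : List Mono).length ≤ M ∧
        ∀ q ∈ ([⟨c, p.factors⟩] : List Mono), q.factors.length ≤ n := fun c =>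
      ⟨by simpa using hpos, by simpa using hp.1⟩
    apply Costs.ite
    · exact fun _ => hrestore U _ hU (hsingle _)
    · exact fun _ => Costs.rewriteTerms hp _ fun terms hterms => hrestore U terms hU hterms
  · have h1 : n * (64 * n + 5) + 1 ≤ 70 * ((n + 1) * M) := by nlinarith
    have h2 : M * (n * (64 * n + 5) + 1) ≤ 70 * ((n + 1) * (M * M)) := by
      calc M * (n * (64 * n + 5) + 1) ≤ M * (70 * ((n + 1) * M)) := Nat.mul_le_mul_left _ h1
        _ = 70 * ((n + 1) * (M * M)) := by ring
    have h3 : M ≤ (n + 1) * (M * M) :=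
      (Nat.le_mul_of_pos_right M hpos).trans (Nat.le_mul_of_pos_left _ (Nat.succ_pos n))
    omega

end RiemCanon

theorem mainTheorem3 :
    ∃ C : ℕ, ∀ (n : ℕ) (f : RiemCanon.RMonomial), f.degree = n → f.IsProper → f.IsConnected →
      RiemCanon.TakesAtMost (RiemCanon.normal f) (C * (n * 9 ^ n)) := by
  refine ⟨4000000, fun n f hn hf hconn => ?_⟩
  have hpos : 1 ≤ n := by
    obtain ⟨i⟩ := hconn.nonempty
    rw [← hn]
    exact Nat.one_le_of_lt i.2
  refine ((RiemCanon.Costs.normal hn hf).le ?_).takesAtMost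
  rw [← mul_pow]
  norm_num
  have : (n + 1) * 9 ^ n ≤ 2 * n * 9 ^ n := by gcongr; omega
  linarith
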